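/- **Conventions.** A net of order $n\ge 1$ and degree $k\ge 1$ is a set $P$ of $n^2$ points with a set $L$ of $kn$ lines (subsets of $P$) such that each line has $n$ points, each point lies on exactly $k$ lines, and the lines fall into $k$ parallel classes: two distinct lines of the same class are disjoint, and two lines of different classes share exactly one point. Its net graph ($k$-net graph of order $n$) has vertex set $P$, two distinct points being adjacent iff they lie on a common line. A graph on $N$ vertices is given by its $N\times N$ adjacency matrix, written row by row. Circuit families $(C_m)_{m\in\mathbb N}$ ($C_m$ reads $m$ bits and has several output bits) are logspace uniform: a deterministic Turing machine computes $1^m\mapsto\langle C_m\rangle$ with $O(\log m)$ work space. They have polynomial size and constant depth. The gates are unbounded fan-in $\mathsf{AND}$, $\mathsf{OR}$ and $\mathsf{NOT}$ for $\mathsf{AC}^0$, and additionally unbounded fan-in $\mathsf{Majority}$ for $\mathsf{TC}^0$. **Lemma.** Let $G$ be the net graph of a net $\mathcal N$ of order $n$ and degree $k$, on the $N=n^2$ vertices $\{0,\dots,N-1\}$, with $n>(k-1)^2$. 1. $\mathcal N$ can be reconstructed from $G$ in $\mathsf{TC}^0$: there is one logspace uniform $\mathsf{TC}^0$ family which, for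 all such $n,k,\mathcal N$, maps the adjacency matrix of $G$ to an $N\times N^2$ matrix over $\{0,1\}$ whose first $kn$ columns form the point-block incidence matrix of $\mathcal N$ (each line is listed exactly once, in some order) and whose other columns are $0$. 2. If $k$ is bounded, $\mathcal N$ can be reconstructed from $G$ in $\mathsf{AC}^0$: for every $K$ there is one logspace uniform $\mathsf{AC}^0$ family which, for all such $n,k,\mathcal N$ with $k\le K$, maps the adjacency matrix of $G$ to an $N\times N^2$ matrix over $\{0,1\}$ whose nonzero columns are the indicator vectors of the lines of $\mathcal N$, each line exactly once (zero columns may stand anywhere). 3. Let $u,v$ be adjacent points, and let $H$ be the subgraph of $G$ induced by $u$, $v$ and their common neighbours. There is exactly one line $\ell$ through $u$ and $v$. It is a clique contained in $H$; each point of $\ell$ has degree at least $n-1$ in $H$, and each vertex of $H$ outside $\ell$ has degree less than $(k-1)^2$ in $H$ (and $(k-1)^2\le n-1$). -/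

import Mathlib

/-! ### Boolean circuits -/

/-- The gate types; all of them except `not` have unbounded fan-in. -/
inductive GateKind
  | and
  | or
  | not
  | maj
  deriving DecidableEq

/-- A gate: its type and the list of the nodes that it reads. In a circuit on `m` input bits the
nodes `0, …, m - 1` are the inputs and node `m + i` is gate number `i`. -/
structure Gate where
  kind : GateKind
  args : List ℕ

/-- A circuit with several output bits: gates in topological order, and the list of output nodes. -/
structure Circuit where
  gates : List Gate
  outputs : List ℕ

/-- The value of a gate, given the values of the earlier nodes. A majority gate is true iff at
least half of its inputs are true. -/
def Gate.value (g : Gate) (vs : List Bool) : Bool :=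
  match g.kind with
  | .and => g.args.all fun a => vs.getD a false
  | .or => g.args.any fun a => vs.getD a false
  | .not => !(vs.getD (g.args.headD 0) false)
  | .maj => decide (g.args.length ≤ 2 * g.args.countP fun a => vs.getD a false)

namespace Circuit

/-- `C` is a circuit on `m` input bits: gates read only inputs and earlier gates, negations have
one input, and the outputs are nodes of the circuit. -/
structure WellFormed (m : ℕ) (C : Circuit) : Prop where
  args_lt : ∀ (i : ℕ) (g : Gate), C.gates[i]? = some g → ∀ a ∈ g.args, a < m + i
  not_unary : ∀ g ∈ C.gates, g.kind = .not → g.args.length = 1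
  outputs_lt : ∀ o ∈ C.outputs, o < m + C.gates.length

/-- The values of all nodes on the input `x`. -/
def nodeValues (C : Circuit) (x : List Bool) : List Bool :=
  C.gates.foldl (fun vs g => vs ++ [g.value vs]) x

/-- The output string of `C` on the input `x`. -/
def output (C : Circuit) (x : List Bool) : List Bool :=
  C.outputs.map fun o => (C.nodeValues x).getD o false

/-- The depths of all nodes of a circuit on `m` input bits; inputs have depth `0`. -/
def nodeDepths (m : ℕ) (C : Circuit) : List ℕ :=
  C.gates.foldl (fun ds g => ds ++ [(g.args.map fun a => ds.getD a 0).foldr max 0 + 1])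
    (List.replicate m 0)

/-- The depth: the largest number of gates on a path (negations are counted). -/
def depth (m : ℕ) (C : Circuit) : ℕ := (C.nodeDepths m).foldr max 0

/-- The size: the number of gates plus the number of wires. -/
def size (C : Circuit) : ℕ := C.gates.length + (C.gates.map fun g => g.args.length).sum

end Circuit

/-! ### Encoding of circuits as strings -/

/-- The alphabet in which circuits are written down. -/
inductive CircuitSymbol
  | tick
  | sep
  | gate (kind : GateKind)
  | out

/-- A node number in unary, followed by a separator. (Node numbers in a circuit of polynomial size
are polynomially bounded, so unary and binary numbering are interchangeable in logarithmic
space.) -/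
def encodeNode (a : ℕ) : List CircuitSymbol := List.replicate a .tick ++ [.sep]

/-- A gate: its type, followed by the nodes that it reads. -/
def Gate.encode (g : Gate) : List CircuitSymbol := .gate g.kind :: g.args.flatMap encodeNode

/-- A circuit on `m` inputs: the number `m`, the gates in their order, the outputs. -/
def Circuit.encode (m : ℕ) (C : Circuit) : List CircuitSymbol :=
  encodeNode m ++ C.gates.flatMap Gate.encode ++ .out :: C.outputs.flatMap encodeNode

/-! ### Deterministic Turing machines with a read-only input tape, work tapes and a write-only
output tape -/

inductive TapeMove
  | left
  | stay
  | right

/-- Head movement on a tape with cells `0, 1, 2, …`; moving left from cell `0` has no effect. -/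
def TapeMove.apply : TapeMove → ℕ → ℕ
  | .left, p => p - 1
  | .stay, p => p
  | .right, p => p + 1

/-- What the input head reads: an end marker or a letter of the input. -/
inductive InputSymbol (α : Type)
  | leftEnd
  | letter (a : α)
  | rightEnd

/-- The input tape for `w`: the left marker in cell `0`, the letters in cells `1, …, |w|`, and the
right marker in cell `|w| + 1`. -/
def readInput {α : Type} (w : List α) : ℕ → InputSymbol α
  | 0 => .leftEnd
  | p + 1 => match w[p]? with
    | some a => .letter a
    | none => .rightEnd

/-- A deterministic Turing transducer with input alphabet `α`, output alphabet `σ`, finitely many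
states, and finitely many work tapes over a finite alphabet. In one step it reads the input cell
and the work cells under its heads; it halts (`none`), or it changes its state, moves the input
head, writes and moves on each work tape, and appends at most one symbol to the output. -/
structure Transducer (α σ : Type) where
  State : Type
  finiteState : Finite State
  Sym : Type
  finiteSym : Finite Sym
  blank : Sym
  tapes : ℕ
  start : State
  step : State → InputSymbol α → (Fin tapes → Sym) →
    Option (State × TapeMove × (Fin tapes → Sym × TapeMove) × Option σ)

namespace Transducer

variable {α σ : Type}

/-- A configuration: state, input head, contents and heads of the work tapes, output so far. -/
structure Config (M : Transducer α σ) where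
  state : M.State
  inputHead : ℕ
  work : Fin M.tapes → ℕ → M.Sym
  head : Fin M.tapes → ℕ
  out : List σ

/-- The start configuration: all work tapes are blank and all heads are in cell `0`. -/
def startConfig (M : Transducer α σ) : M.Config where
  state := M.start
  inputHead := 0
  work := fun _ _ => M.blank
  head := fun _ => 0
  out := []

/-- One step on the input `w`; `none` if the machine halts. The input head cannot leave the cells
`0, …, |w| + 1`. -/
def next (M : Transducer α σ) (w : List α) (c : M.Config) : Option M.Config :=
  match M.step c.state (readInput w c.inputHead) (fun j => c.work j (c.head j)) with
  | none => none
  | some (q, d, act, o) => some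
      { state := q
        inputHead := min (d.apply c.inputHead) (w.length + 1)
        work := fun j => Function.update (c.work j) (c.head j) (act j).1
        head := fun j => (act j).2.apply (c.head j)
        out := c.out ++ o.toList }

/-- On the input `w` the machine halts with output `y`, and throughout the computation it visits
only the first `s` cells of each of its work tapes. -/
def ComputesWithin (M : Transducer α σ) (w : List α) (y : List σ) (s : ℕ) : Prop :=
  (∃ c, StateTransition.Reaches (M.next w) M.startConfig c ∧ M.next w c = none ∧ c.out = y) ∧
  ∀ c, StateTransition.Reaches (M.next w) M.startConfig c → ∀ j, c.head j < s

end Transducer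

/-! ### Logspace uniform `TC⁰` and `AC⁰` -/

/-- Circuit number `m` reads `m` input bits. -/
abbrev CircuitFamily := ℕ → Circuit

namespace CircuitFamily

/-- A deterministic Turing machine computes `1ᵐ ↦ ⟨C m⟩` in space `O(log m)`. -/
def LogspaceUniform (C : CircuitFamily) : Prop :=
  ∃ (M : Transducer Unit CircuitSymbol) (c : ℕ), ∀ m : ℕ,
    M.ComputesWithin (List.replicate m ()) ((C m).encode m) (c * (Nat.log 2 m + 1))

/-- A logspace uniform `TC⁰` circuit family: polynomial size, constant depth, and gates `AND`,
`OR`, `MAJORITY` of unbounded fan-in and `NOT`. -/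
structure IsTC0 (C : CircuitFamily) : Prop where
  wellFormed : ∀ m, (C m).WellFormed m
  polySize : ∃ c : ℕ, ∀ m, (C m).size ≤ m ^ c + c
  constDepth : ∃ d : ℕ, ∀ m, (C m).depth m ≤ d
  uniform : C.LogspaceUniform

/-- A logspace uniform `AC⁰` circuit family: as for `TC⁰`, but without majority gates. -/
structure IsAC0 (C : CircuitFamily) : Prop extends C.IsTC0 where
  noMaj : ∀ m, ∀ g ∈ (C m).gates, g.kind ≠ .maj

end CircuitFamily

/-! ### Nets and net graphs -/

/-- `lines` is the set of lines of a net of order `n` and degree `k` on the point set `P`. -/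
structure IsNet {P : Type} [Fintype P] [DecidableEq P] (n k : ℕ) (lines : Finset (Finset P)) :
    Prop where
  one_le_order : 1 ≤ n
  one_le_degree : 1 ≤ k
  card_points : Fintype.card P = n ^ 2
  card_lines : lines.card = k * n
  card_line : ∀ l ∈ lines, l.card = n
  card_through : ∀ p : P, (lines.filter fun l => p ∈ l).card = k
  parallel : ∃ cls : Finset P → Fin k, ∀ l₁ ∈ lines, ∀ l₂ ∈ lines, l₁ ≠ l₂ →
    (cls l₁ = cls l₂ → Disjoint l₁ l₂) ∧ (cls l₁ ≠ cls l₂ → (l₁ ∩ l₂).card = 1)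

/-- The net graph: distinct points are adjacent iff they lie on a common line. -/
def netGraph {P : Type} (lines : Finset (Finset P)) : SimpleGraph P where
  Adj u v := u ≠ v ∧ ∃ l ∈ lines, u ∈ l ∧ v ∈ l
  symm := ⟨fun _ _ h => ⟨h.1.symm, h.2.imp fun _ hl => ⟨hl.1, hl.2.2, hl.2.1⟩⟩⟩
  loopless := ⟨fun _ h => h.1 rfl⟩

/-! ### Graphs and nets as bit strings -/

/-- A `0/1` matrix written row by row. -/
def matrixBits {N M : ℕ} (B : Fin N → Fin M → Bool) : List Bool :=
  List.ofFn fun i : Fin (N * M) => B i.divNat i.modNat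

open Classical in
/-- The adjacency matrix of a graph, written row by row. -/
noncomputable def graphBits {N : ℕ} (G : SimpleGraph (Fin N)) : List Bool :=
  matrixBits fun u v => decide (G.Adj u v)

/-- The set of points incident with column `j` of a point-block matrix. -/
def column {N M : ℕ} (B : Fin N → Fin M → Bool) (j : Fin M) : Finset (Fin N) :=
  Finset.univ.filter fun p => B p j = true

/-- The column `f l` is the indicator vector of the line `l`, different lines have different
columns, and all columns that belong to no line are zero. -/
def ListsLines {N M : ℕ} (lines : Finset (Finset (Fin N))) (B : Fin N → Fin M → Bool)
    (f : lines ↪ Fin M) : Prop :=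
  (∀ l : lines, column B (f l) = l) ∧ ∀ j, j ∉ Set.range f → column B j = ∅

/-- `B` is the point-block incidence matrix of the net (for some order of its lines), with zero
columns allowed in any places. -/
def IsSparseIncidenceMatrix {N M : ℕ} (lines : Finset (Finset (Fin N)))
    (B : Fin N → Fin M → Bool) : Prop :=
  ∃ f : lines ↪ Fin M, ListsLines lines B f

/-- The first `|lines|` columns of `B` are the point-block incidence matrix of the net (for some
order of its lines), and the remaining columns are zero. -/
def IsIncidenceMatrix {N M : ℕ} (lines : Finset (Finset (Fin N)))
    (B : Fin N → Fin M → Bool) : Prop :=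
  ∃ f : lines ↪ Fin M, ListsLines lines B f ∧ ∀ l : lines, (f l : ℕ) < lines.card

/-! ### The neighbourhood of an edge -/

open Classical in
/-- The vertices `u` and `v` together with their common neighbours. -/
noncomputable def edgeNhd {P : Type} [Fintype P] (G : SimpleGraph P) (u v : P) : Finset P :=
  Finset.univ.filter fun z => z = u ∨ z = v ∨ (G.Adj u z ∧ G.Adj v z)

open Classical in
/-- The number of neighbours of `w` in `S`. -/
noncomputable def degreeIn {P : Type} (G : SimpleGraph P) (S : Finset P) (w : P) : ℕ :=
  (S.filter fun z => G.Adj w z).card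

/-!
Let `ℓ` be the line through two adjacent points `u` and `v` and let `H` be the neighbourhood of the
edge `u v`. A point of `H` outside `ℓ` is determined by the two distinct classes, both different
from that of `ℓ`, of its lines through `u` and through `v`, and it has at most `k - 1` neighbours on
`ℓ`. So its degree in `H` is less than `(k - 1) ^ 2 ≤ n - 1`, while the points of `ℓ` have degree at
least `n - 1`, and `ℓ` is recognized by degrees. Ordering the points, a line is represented by its
first two points, and a majority gate numbers the lines by counting smaller representatives. For
bounded `k`, degrees need to be compared with constants only, and the column `(u, v)` receives the
line whose first two points are `u` and `v`.

Both reconstructions are queries built from adjacency and the order by Boolean operations,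
quantifiers and, for unbounded `k`, comparison of numbers of pairs. One layer of gates, with a gate
for every tuple of vertices, evaluates one such operation. The descriptions of these layers are
nested loops over counters of polynomial size, which a logspace transducer runs.
-/

/-! ### Counter programs on a one-tape transducer -/

namespace Transducer

variable {α σ : Type} {M : Transducer α σ} {w : List α} {s : ℕ} {y : List σ} {c c' : M.Config}

/-- The computation that continues from `c` halts with output `y` and stays within the first `s`
cells of each work tape: `ComputesWithin` for an arbitrary configuration. -/
def HaltsWithin (M : Transducer α σ) (w : List α) (y : List σ) (s : ℕ) (c : M.Config) : Prop :=
  (∃ d, StateTransition.Reaches (M.next w) c d ∧ M.next w d = none ∧ d.out = y) ∧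
  ∀ d, StateTransition.Reaches (M.next w) c d → ∀ j, d.head j < s

theorem HaltsWithin.of_next (h : M.next w c = some c') (hs : ∀ j, c.head j < s)
    (hc : M.HaltsWithin w y s c') : M.HaltsWithin w y s c := by
  obtain ⟨⟨d, hd, hhalt, hout⟩, hspace⟩ := hc
  refine ⟨⟨d, Relation.ReflTransGen.head h hd, hhalt, hout⟩, fun e he => ?_⟩
  rcases Relation.ReflTransGen.cases_head he with rfl | ⟨f, hf, hfe⟩
  · exact hs
  · obtain rfl : c' = f := Option.some_injective _ (h.symm.trans hf)
    exact hspace e hfe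

theorem HaltsWithin.of_next_eq_none (h : M.next w c = none) (hs : ∀ j, c.head j < s) :
    M.HaltsWithin w c.out s c := by
  refine ⟨⟨c, Relation.ReflTransGen.refl, h, rfl⟩, fun e he => ?_⟩
  rcases Relation.ReflTransGen.cases_head he with rfl | ⟨f, hf, -⟩
  · exact hs
  · exact absurd (h.symm.trans hf) (by simp)

end Transducer

/-- The carry into bit `j`, when `n` is incremented, is `2 ^ j ∣ n + 1`. -/
theorem testBit_succ_eq_xor (n j : ℕ) :
    (n + 1).testBit j = (decide (2 ^ j ∣ n + 1) ^^ n.testBit j) := by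
  rw [Nat.testBit_eq_decide_div_mod_eq, Nat.testBit_eq_decide_div_mod_eq, Nat.succ_div,
    Bool.eq_iff_iff]
  by_cases h : 2 ^ j ∣ n + 1 <;> simp only [h, if_true, if_false, decide_true, decide_false,
    Bool.true_xor, Bool.false_xor, Bool.not_eq_true', decide_eq_true_eq, decide_eq_false_iff_not]
  all_goals omega

theorem decide_two_pow_succ_dvd_succ (n j : ℕ) :
    decide (2 ^ (j + 1) ∣ n + 1) = (decide (2 ^ j ∣ n + 1) && n.testBit j) := by
  by_cases h : 2 ^ j ∣ n + 1
  · have hbit := testBit_succ_eq_xor n j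
    obtain ⟨q, hq⟩ := h
    have hq2 : 2 ^ (j + 1) ∣ n + 1 ↔ q % 2 = 0 := by
      rw [hq, pow_succ, Nat.mul_dvd_mul_iff_left (Nat.two_pow_pos j), Nat.dvd_iff_mod_eq_zero]
    have hqbit : (n + 1).testBit j = decide (q % 2 = 1) := by
      rw [Nat.testBit_eq_decide_div_mod_eq, hq, Nat.mul_div_cancel_left q (Nat.two_pow_pos j)]
    rcases Nat.mod_two_eq_zero_or_one q with h | h <;> simp_all
  · have : ¬ 2 ^ (j + 1) ∣ n + 1 := fun h' => h ((pow_dvd_pow 2 j.le_succ).trans h')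
    simp [h, this]

theorem decide_mod_two_pow_succ_lt (a b j : ℕ) :
    decide (a % 2 ^ (j + 1) < b % 2 ^ (j + 1)) =
      if a.testBit j = b.testBit j then decide (a % 2 ^ j < b % 2 ^ j) else b.testBit j := by
  have ha := Nat.mod_lt a (Nat.two_pow_pos j)
  have hb := Nat.mod_lt b (Nat.two_pow_pos j)
  rw [Nat.testBit_eq_decide_div_mod_eq, Nat.testBit_eq_decide_div_mod_eq, Nat.mod_pow_succ,
    Nat.mod_pow_succ]
  rcases Nat.mod_two_eq_zero_or_one (a / 2 ^ j) with ha' | ha' <;>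
  rcases Nat.mod_two_eq_zero_or_one (b / 2 ^ j) with hb' | hb' <;> simp [ha', hb'] <;> omega

/-- Programs over registers that hold natural numbers. `eachLetter a` carries out `a` once for each
letter of the input, `ite r s a b` and `whileLt r s a` test whether register `r` is less than
register `s`. -/
inductive Cmd (σ : Type)
  | emit (x : σ)
  | inc (r : ℕ)
  | clear (r : ℕ)
  | seq (a b : Cmd σ)
  | ite (r s : ℕ) (a b : Cmd σ)
  | whileLt (r s : ℕ) (a : Cmd σ)
  | eachLetter (a : Cmd σ)

/-- A column of the work tape: one bit of each of the registers `0, …, R - 1`. -/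
abbrev Col (R : ℕ) := Fin R → Bool

/-- The work alphabet: blank (`none`), the marker of the left end (`some none`), and columns. -/
abbrev Cell (R : ℕ) := Option (Option (Col R))

namespace Col

variable {R : ℕ}

/-- The bit of register `r`; `false` if the tape does not hold this register. -/
def bit (c : Col R) (r : ℕ) : Bool := if h : r < R then c ⟨r, h⟩ else false

/-- The column with the bit of register `r` replaced. -/
def set (c : Col R) (r : ℕ) (b : Bool) : Col R := fun i => if i.val = r then b else c i

/-- The column of the bits number `i` of the registers `ρ`. -/
def ofBits (R : ℕ) (ρ : ℕ → ℕ) (i : ℕ) : Col R := fun r => (ρ r).testBit i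

theorem bit_ofBits (ρ : ℕ → ℕ) (i : ℕ) {r : ℕ} (hr : r < R) :
    (ofBits R ρ i).bit r = (ρ r).testBit i := by
  simp [bit, ofBits, hr]

theorem set_ofBits (ρ : ℕ → ℕ) (i r v : ℕ) :
    (ofBits R ρ i).set r (v.testBit i) = ofBits R (Function.update ρ r v) i := by
  funext j
  by_cases h : j.val = r <;> simp [set, ofBits, h]

end Col

/-- The work tape with the marker in cell `0` and the columns `f 0, …, f (L - 1)` after it. -/
def tapeOf {R : ℕ} (f : ℕ → Col R) (L : ℕ) : ℕ → Cell R
  | 0 => some none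
  | i + 1 => if i < L then some (some (f i)) else none

section Tape

variable {R L i : ℕ} {f g : ℕ → Col R}

theorem tapeOf_succ_of_lt (h : i < L) : tapeOf f L (i + 1) = some (some (f i)) := if_pos h

theorem tapeOf_succ_self : tapeOf f L (L + 1) = none := if_neg (lt_irrefl L)

theorem tapeOf_succ_ne_marker : tapeOf f L (i + 1) ≠ some none := by
  simp only [tapeOf]
  split_ifs <;> simp

theorem tapeOf_congr (h : ∀ i < L, f i = g i) : tapeOf f L = tapeOf g L := by
  funext i
  cases i with
  | zero => rfl
  | succ i =>
    simp only [tapeOf]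
    split_ifs with hi
    · rw [h i hi]
    · rfl

theorem update_tapeOf_of_lt (h : i < L) (x : Col R) :
    Function.update (tapeOf f L) (i + 1) (some (some x)) =
      tapeOf (Function.update f i x) L := by
  funext j
  rcases eq_or_ne j (i + 1) with rfl | hj
  · simp [tapeOf, h]
  · rw [Function.update_of_ne hj]
    cases j with
    | zero => rfl
    | succ j =>
      have hne : j ≠ i := fun h => hj (h ▸ rfl)
      simp only [tapeOf, Function.update_of_ne hne]

theorem update_tapeOf_none :
    Function.update (tapeOf f L) (L + 1) none = tapeOf f L :=
  Function.update_eq_self_iff.2 tapeOf_succ_self.symm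

theorem update_tapeOf_self :
    Function.update (tapeOf f L) (L + 1) (some (some (f L))) = tapeOf f (L + 1) := by
  funext j
  rcases eq_or_ne j (L + 1) with rfl | hj
  · simp [tapeOf]
  · rw [Function.update_of_ne hj]
    cases j with
    | zero => rfl
    | succ j =>
      have : j < L ↔ j < L + 1 := by omega
      simp only [tapeOf, this]

end Tape

namespace Cmd

variable {σ : Type} {R : ℕ}

/-- Whether the command is carried out by a sweep: a run of the head over all columns, from the
least significant bit on, and back to the marker, with one bit of memory. -/
def IsSweep : Cmd σ → Prop
  | inc _ | clear _ | ite _ _ _ _ | whileLt _ _ _ => True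
  | _ => False

/-- The memory bit at the start of a sweep: the carry of an increment, or the result of the
comparison of the bits read so far. -/
def sweepInit : Cmd σ → Bool
  | inc _ => true
  | _ => false

/-- One step of a sweep: the new memory bit and the new column. -/
def sweepStep : Cmd σ → Bool → Col R → Bool × Col R
  | inc r, b, c => (b && c.bit r, c.set r (b ^^ c.bit r))
  | clear r, b, c => (b, c.set r false)
  | ite r s _ _, b, c | whileLt r s _, b, c => (if c.bit r = c.bit s then b else c.bit s, c)
  | _, b, c => (b, c)

/-- The column that a sweep appends at the right end, if any: an increment appends its carry. -/
def sweepEnd : Cmd σ → Bool → Option (Col R)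
  | inc r, true => some (Col.set (fun _ => false) r true)
  | _, _ => none

/-- The commands that remain to be carried out after a sweep. -/
def dispatch : Cmd σ → Bool → List (Cmd σ) → List (Cmd σ)
  | ite _ _ a _, true, k => a :: k
  | ite _ _ _ b, false, k => b :: k
  | whileLt r s a, true, k => a :: whileLt r s a :: k
  | _, _, k => k

/-- The continuations, other than `k`, that occur while `c :: k` is carried out until `k`
remains. They are finitely many, and therefore serve as states of the interpreter. -/
def continuations : Cmd σ → List (Cmd σ) → Set (List (Cmd σ))
  | seq a b, k => insert (seq a b :: k) (continuations a (b :: k) ∪ continuations b k)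
  | ite r s a b, k => insert (ite r s a b :: k) (continuations a k ∪ continuations b k)
  | whileLt r s a, k => insert (whileLt r s a :: k) (continuations a (whileLt r s a :: k))
  | eachLetter a, k => insert (eachLetter a :: k) (continuations a (eachLetter a :: k))
  | c, k => {c :: k}

theorem finite_continuations (c : Cmd σ) (k : List (Cmd σ)) : (c.continuations k).Finite := by
  induction c generalizing k with
  | seq a b iha ihb => exact ((iha _).union (ihb _)).insert _
  | ite r s a b iha ihb => exact ((iha _).union (ihb _)).insert _
  | whileLt r s a ih => exact (ih _).insert _
  | eachLetter a ih => exact (ih _).insert _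
  | _ => exact Set.finite_singleton _

theorem cons_mem_continuations (c : Cmd σ) (k : List (Cmd σ)) : c :: k ∈ c.continuations k := by
  cases c <;> simp [continuations]

end Cmd

/-- The phases of the interpreter; `right` and `back` are the two halves of a sweep, with its
memory bit. -/
inductive Phase
  | init
  | ready
  | right (b : Bool)
  | back (b : Bool)
  deriving Fintype

section Interpreter

variable {σ : Type} {R : ℕ}

/-- The instruction table of the interpreter. The first component of a state is the list of the
commands that remain to be carried out. -/
def instruction : List (Cmd σ) × Phase → InputSymbol Unit → Cell R →
    Option ((List (Cmd σ) × Phase) × TapeMove × Cell R × TapeMove × Option σ)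
  | (k, .init), _, _ => some ((k, .ready), .stay, some none, .stay, none)
  | ([], _), _, _ => none
  | (.emit x :: k, .ready), _, a => some ((k, .ready), .stay, a, .stay, some x)
  | (.seq c d :: k, .ready), _, a => some ((c :: d :: k, .ready), .stay, a, .stay, none)
  | (.eachLetter c :: k, .ready), .leftEnd, a =>
      some ((.eachLetter c :: k, .ready), .right, a, .stay, none)
  | (.eachLetter c :: k, .ready), .letter _, a =>
      some ((c :: .eachLetter c :: k, .ready), .right, a, .stay, none)
  | (.eachLetter _ :: k, .ready), .rightEnd, a => some ((k, .ready), .stay, a, .stay, none)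
  | (c :: k, .ready), _, a => some ((c :: k, .right c.sweepInit), .stay, a, .right, none)
  | (c :: k, .right b), _, some (some a) =>
      some ((c :: k, .right (c.sweepStep b a).1), .stay, some (some (c.sweepStep b a).2), .right,
        none)
  | (c :: k, .right b), _, _ =>
      some ((c :: k, .back b), .stay, (c.sweepEnd b).map some, .left, none)
  | (c :: k, .back b), _, some none =>
      some ((c.dispatch b k, .ready), .stay, some none, .stay, none)
  | (c :: k, .back b), _, a => some ((c :: k, .back b), .stay, a, .left, none)

open Classical in
/-- A list of commands as an element of `S`, with the default value `k₀` for lists outside `S`,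
which never occur. -/
noncomputable def clamp {S : Set (List (Cmd σ))} (k₀ : S) (k : List (Cmd σ)) : S :=
  if h : k ∈ S then ⟨k, h⟩ else k₀

/-- The interpreter of the commands `k₀`, where the finite set `S` contains all continuations. -/
noncomputable def interpreter (R : ℕ) (S : Set (List (Cmd σ))) [Finite S] (k₀ : S) :
    Transducer Unit σ where
  State := S × Phase
  finiteState := inferInstance
  Sym := Cell R
  finiteSym := inferInstance
  blank := none
  tapes := 1
  start := (k₀, .init)
  step q a x := (instruction (q.1.val, q.2) a (x 0)).map fun z =>
    ((clamp k₀ z.1.1, z.1.2), z.2.1, fun _ => (z.2.2.1, z.2.2.2.1), z.2.2.2.2)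

variable {S : Set (List (Cmd σ))} [Finite S] {k₀ : S} {w : List Unit} {B : ℕ}

/-- The configuration of the interpreter with commands `k`, phase `p`, tape `T`, work head `h`,
input head `i`. -/
noncomputable def conf (k₀ : S) (k : List (Cmd σ)) (p : Phase) (T : ℕ → Cell R) (h i : ℕ)
    (out : List σ) : (interpreter R S k₀).Config where
  state := (clamp k₀ k, p)
  inputHead := i
  work := fun _ => T
  head := fun _ => h
  out := out

variable {c : Cmd σ} {k : List (Cmd σ)} {i h : ℕ} {out y : List σ} {b : Bool} {T : ℕ → Cell R}
  {p : Phase}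

theorem next_conf (hk : k ∈ S) :
    (interpreter R S k₀).next w (conf k₀ k p T h i out) =
      (instruction (k, p) (readInput w i) (T h)).map fun z =>
        conf k₀ z.1.1 z.1.2 (Function.update T h z.2.2.1) (z.2.2.2.1.apply h)
          (min (z.2.1.apply i) (w.length + 1)) (out ++ z.2.2.2.2.toList) := by
  have hclamp : (clamp k₀ k).val = k := by simp [clamp, hk]
  simp only [Transducer.next, interpreter, conf, hclamp]
  cases instruction (k, p) (readInput w i) (T h) <;> rfl

theorem haltsWithin_conf (hk : k ∈ S) {q : List (Cmd σ) × Phase} {d d' : TapeMove} {x : Cell R}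
    {o : Option σ} (ht : instruction (k, p) (readInput w i) (T h) = some (q, d, x, d', o))
    (hB : h < B + 2)
    (hnext : (interpreter R S k₀).HaltsWithin w y (B + 2) (conf k₀ q.1 q.2
      (Function.update T h x) (d'.apply h) (min (d.apply i) (w.length + 1)) (out ++ o.toList))) :
    (interpreter R S k₀).HaltsWithin w y (B + 2) (conf k₀ k p T h i out) :=
  Transducer.HaltsWithin.of_next (by rw [next_conf hk, ht]; rfl) (fun _ => hB) hnext

/-- The tape `T` holds the registers `ρ`, in at most `B` columns. -/
def Holds (B : ℕ) (ρ : ℕ → ℕ) (T : ℕ → Cell R) : Prop :=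
  ∃ L ≤ B, (∀ r < R, ρ r < 2 ^ L) ∧ T = tapeOf (Col.ofBits R ρ) L

/-- With the registers `ρ` on its tape and `out` written, the interpreter is about to carry out
the commands `k`, and it will halt with the output `y`. -/
def Ready (R : ℕ) (w : List Unit) (B : ℕ) (y : List σ) (k₀ : S) (k : List (Cmd σ)) (ρ : ℕ → ℕ)
    (i : ℕ) (out : List σ) : Prop :=
  ∀ T, Holds (R := R) B ρ T →
    (interpreter R S k₀).HaltsWithin w y (B + 2) (conf k₀ k .ready T 0 i out)

theorem haltsWithin_back (hk : c :: k ∈ S) (hi : i ≤ w.length + 1) {f : ℕ → Col R} {L : ℕ}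
    (hh : h < B + 2)
    (hnext : (interpreter R S k₀).HaltsWithin w y (B + 2)
      (conf k₀ (c.dispatch b k) .ready (tapeOf f L) 0 i out)) :
    (interpreter R S k₀).HaltsWithin w y (B + 2)
      (conf k₀ (c :: k) (.back b) (tapeOf f L) h i out) := by
  induction h with
  | zero =>
    refine haltsWithin_conf hk (q := (c.dispatch b k, .ready)) (d := .stay) (x := tapeOf f L 0)
      (d' := .stay) (o := none) rfl hh ?_
    rw [Function.update_eq_self]
    simpa [TapeMove.apply, hi] using hnext
  | succ h ih =>
    refine haltsWithin_conf hk (q := (c :: k, .back b)) (d := .stay) (x := tapeOf f L (h + 1))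
      (d' := .left) (o := none) ?_ hh ?_
    · rcases hx : tapeOf f L (h + 1) with _ | _ | x
      · rfl
      · exact absurd hx tapeOf_succ_ne_marker
      · rfl
    · rw [Function.update_eq_self]
      simpa [TapeMove.apply, hi] using ih (by omega)

theorem haltsWithin_right (hk : c :: k ∈ S) (hi : i ≤ w.length + 1) {L : ℕ} (hL : L ≤ B)
    {f g : ℕ → Col R} {mem : ℕ → Bool}
    (hstep : ∀ j < L, c.sweepStep (mem j) (f j) = (mem (j + 1), g j))
    (hnext : (interpreter R S k₀).HaltsWithin w y (B + 2) (conf k₀ (c :: k) (.back (mem L))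
      (Function.update (tapeOf g L) (L + 1) ((c.sweepEnd (mem L)).map some)) L i out))
    {j : ℕ} (hj : j ≤ L) :
    (interpreter R S k₀).HaltsWithin w y (B + 2) (conf k₀ (c :: k) (.right (mem j))
      (tapeOf (fun a => if a < j then g a else f a) L) (j + 1) i out) := by
  induction hj using Nat.decreasingInduction with
  | self =>
    rw [tapeOf_congr (g := g) fun a ha => if_pos ha]
    refine haltsWithin_conf hk (q := (c :: k, .back (mem L))) (d := .stay)
      (x := (c.sweepEnd (mem L)).map some) (d' := .left) (o := none)
      (by rw [tapeOf_succ_self]; rfl) (by omega) ?_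
    simpa [TapeMove.apply, hi] using hnext
  | of_succ j hj ih =>
    refine haltsWithin_conf hk (q := (c :: k, .right (mem (j + 1)))) (d := .stay)
      (x := some (some (g j))) (d' := .right) (o := none) ?_ (by omega) ?_
    · rw [tapeOf_succ_of_lt hj, if_neg (lt_irrefl j)]
      simp only [instruction, hstep j hj]
    · rw [update_tapeOf_of_lt hj, tapeOf_congr (g := fun a => if a < j + 1 then g a else f a)]
      · simpa [TapeMove.apply, hi] using ih
      · intro a _
        rcases eq_or_ne a j with rfl | ha
        · simp
        · have : a < j ↔ a < j + 1 := by omega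
          simp only [Function.update_of_ne ha, this]

namespace Ready

variable {ρ ρ' : ℕ → ℕ} {r s : ℕ}

theorem sweep (hc : c.IsSweep) (hk : c :: k ∈ S) (hi : i ≤ w.length + 1) {mem : ℕ → Bool}
    (hinit : mem 0 = c.sweepInit)
    (hstep : ∀ j, c.sweepStep (mem j) (Col.ofBits R ρ j) = (mem (j + 1), Col.ofBits R ρ' j))
    (hend : ∀ L ≤ B, (∀ r < R, ρ r < 2 ^ L) → Ready R w B y k₀ (c.dispatch (mem L) k) ρ' i out ∧
      Holds B ρ' (Function.update (tapeOf (Col.ofBits R ρ') L) (L + 1)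
        ((c.sweepEnd (mem L)).map some))) :
    Ready R w B y k₀ (c :: k) ρ i out := by
  rintro _ ⟨L, hLB, hρ, rfl⟩
  obtain ⟨hready, hholds⟩ := hend L hLB hρ
  have hstart : instruction (c :: k, .ready) (readInput w i) (tapeOf (Col.ofBits R ρ) L 0) =
      some ((c :: k, .right (mem 0)), .stay, tapeOf (Col.ofBits R ρ) L 0, .right, none) := by
    rw [hinit]
    cases c <;> first | rfl | exact hc.elim
  refine haltsWithin_conf hk hstart (by omega) ?_
  rw [Function.update_eq_self]
  have hback := hready _ hholds
  obtain ⟨L', -, -, htape⟩ := hholds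
  rw [htape] at hback
  simpa [TapeMove.apply, hi] using haltsWithin_right hk hi hLB (fun j _ => hstep j)
    (htape ▸ haltsWithin_back hk hi (by omega) hback) (Nat.zero_le L)

theorem holds_update_inc {L : ℕ} (hL : L ≤ B) (hρ : ∀ s < R, ρ s < 2 ^ L) (hr : r < R)
    (hlt : ρ r + 1 < 2 ^ B) :
    Holds B (Function.update ρ r (ρ r + 1)) (Function.update
      (tapeOf (Col.ofBits R (Function.update ρ r (ρ r + 1))) L) (L + 1)
      (((Cmd.inc r : Cmd σ).sweepEnd (decide (2 ^ L ∣ ρ r + 1))).map some)) := by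
  have hfits : ∀ L', L ≤ L' → ρ r + 1 < 2 ^ L' →
      ∀ s < R, Function.update ρ r (ρ r + 1) s < 2 ^ L' := by
    intro L' hL' h s hs
    rcases eq_or_ne s r with rfl | hne
    · simpa using h
    · rw [Function.update_of_ne hne]
      exact (hρ s hs).trans_le (Nat.pow_le_pow_right two_pos hL')
  have hle : ρ r + 1 ≤ 2 ^ L := hρ r hr
  by_cases hcarry : 2 ^ L ∣ ρ r + 1
  · have heq : ρ r + 1 = 2 ^ L := le_antisymm hle (Nat.le_of_dvd (Nat.succ_pos _) hcarry)
    have hcol : Col.set (fun _ => false) r true =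
        Col.ofBits R (Function.update ρ r (ρ r + 1)) L := by
      rw [← Col.set_ofBits, heq, Nat.testBit_two_pow_self]
      congr 1
      funext s
      simp [Col.ofBits, Nat.testBit_lt_two_pow (hρ s s.2)]
    refine ⟨L + 1, (Nat.pow_lt_pow_iff_right one_lt_two).1 (heq ▸ hlt),
      hfits _ L.le_succ (by rw [heq, pow_succ]; have := Nat.two_pow_pos L; omega), ?_⟩
    simp only [hcarry, decide_true, Cmd.sweepEnd, Option.map_some, hcol]
    exact update_tapeOf_self
  · have hne : ρ r + 1 ≠ 2 ^ L := fun h => hcarry h.symm.dvd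
    refine ⟨L, hL, hfits L le_rfl (lt_of_le_of_ne hle hne), ?_⟩
    simp only [hcarry, decide_false, Cmd.sweepEnd, Option.map_none]
    exact update_tapeOf_none

theorem inc (hr : r < R) (hk : .inc r :: k ∈ S) (hi : i ≤ w.length + 1) (hlt : ρ r + 1 < 2 ^ B)
    (hnext : Ready R w B y k₀ k (Function.update ρ r (ρ r + 1)) i out) :
    Ready R w B y k₀ (.inc r :: k) ρ i out := by
  refine Ready.sweep (ρ' := Function.update ρ r (ρ r + 1)) trivial hk hi
    (mem := fun j => decide (2 ^ j ∣ ρ r + 1)) (by simp [Cmd.sweepInit]) (fun j => ?_)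
    fun L hL hρ => ⟨hnext, holds_update_inc hL hρ hr hlt⟩
  rw [decide_two_pow_succ_dvd_succ, ← Col.set_ofBits, testBit_succ_eq_xor]
  simp only [Cmd.sweepStep, Col.bit_ofBits _ _ hr]

theorem clear (hk : .clear r :: k ∈ S) (hi : i ≤ w.length + 1)
    (hnext : Ready R w B y k₀ k (Function.update ρ r 0) i out) :
    Ready R w B y k₀ (.clear r :: k) ρ i out := by
  refine Ready.sweep (ρ' := Function.update ρ r 0) (mem := fun _ => false) trivial hk hi rfl
    (fun j => ?_) fun L hL hρ => ⟨hnext, L, hL, fun s hs => ?_, update_tapeOf_none⟩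
  · simp [Cmd.sweepStep, ← Col.set_ofBits]
  · rcases eq_or_ne s r with rfl | hne
    · simp
    · rw [Function.update_of_ne hne]
      exact hρ s hs

theorem compare (hc : c.IsSweep) (hk : c :: k ∈ S) (hi : i ≤ w.length + 1) (hr : r < R)
    (hs : s < R) (hinit : c.sweepInit = false)
    (hstep : ∀ b (a : Col R),
      c.sweepStep b a = (if a.bit r = a.bit s then b else a.bit s, a))
    (hend : ∀ b, c.sweepEnd (R := R) b = none)
    (hnext : Ready R w B y k₀ (c.dispatch (decide (ρ r < ρ s)) k) ρ i out) :
    Ready R w B y k₀ (c :: k) ρ i out := by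
  refine Ready.sweep (ρ' := ρ) (mem := fun j => decide (ρ r % 2 ^ j < ρ s % 2 ^ j)) hc hk hi
    (by simp [hinit, Nat.mod_one]) (fun j => ?_) fun L hL hρ => ⟨?_, L, hL, hρ, ?_⟩
  · rw [hstep, Col.bit_ofBits _ _ hr, Col.bit_ofBits _ _ hs, ← decide_mod_two_pow_succ_lt]
  · rwa [Nat.mod_eq_of_lt (hρ r hr), Nat.mod_eq_of_lt (hρ s hs)]
  · rw [hend]
    exact update_tapeOf_none

theorem ite {c d : Cmd σ} (hr : r < R) (hs : s < R) (hk : .ite r s c d :: k ∈ S)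
    (hi : i ≤ w.length + 1)
    (hnext : Ready R w B y k₀ ((if ρ r < ρ s then c else d) :: k) ρ i out) :
    Ready R w B y k₀ (.ite r s c d :: k) ρ i out := by
  refine Ready.compare trivial hk hi hr hs rfl (fun _ _ => rfl) (fun _ => rfl) ?_
  by_cases h : ρ r < ρ s <;> simpa [h, Cmd.dispatch] using hnext

theorem whileLt (hr : r < R) (hs : s < R) (hk : .whileLt r s c :: k ∈ S)
    (hi : i ≤ w.length + 1)
    (hnext : Ready R w B y k₀ (if ρ r < ρ s then c :: .whileLt r s c :: k else k) ρ i out) :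
    Ready R w B y k₀ (.whileLt r s c :: k) ρ i out := by
  refine Ready.compare trivial hk hi hr hs rfl (fun _ _ => rfl) (fun _ => rfl) ?_
  by_cases h : ρ r < ρ s <;> simpa [h, Cmd.dispatch] using hnext

theorem of_instruction {k' : List (Cmd σ)} {d : TapeMove} {o : Option σ} (hk : k ∈ S)
    (ht : ∀ x : Cell R,
      instruction (k, .ready) (readInput w i) x = some ((k', .ready), d, x, .stay, o))
    (hnext : Ready R w B y k₀ k' ρ (min (d.apply i) (w.length + 1)) (out ++ o.toList)) :
    Ready R w B y k₀ k ρ i out := by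
  intro T hT
  refine haltsWithin_conf hk (ht (T 0)) (by omega) ?_
  rw [Function.update_eq_self]
  exact hnext T hT

theorem emit {x : σ} (hk : .emit x :: k ∈ S) (hi : i ≤ w.length + 1)
    (hnext : Ready R w B y k₀ k ρ i (out ++ [x])) :
    Ready R w B y k₀ (.emit x :: k) ρ i out :=
  of_instruction hk (fun _ => rfl) (by simpa [TapeMove.apply, hi] using hnext)

theorem seq {c d : Cmd σ} (hk : .seq c d :: k ∈ S) (hi : i ≤ w.length + 1)
    (hnext : Ready R w B y k₀ (c :: d :: k) ρ i out) :
    Ready R w B y k₀ (.seq c d :: k) ρ i out :=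
  of_instruction hk (fun _ => rfl) (by simpa [TapeMove.apply, hi] using hnext)

theorem eachLetter_leftEnd (hk : .eachLetter c :: k ∈ S)
    (hnext : Ready R w B y k₀ (.eachLetter c :: k) ρ 1 out) :
    Ready R w B y k₀ (.eachLetter c :: k) ρ 0 out :=
  of_instruction hk (fun _ => rfl) (by simpa [TapeMove.apply] using hnext)

theorem eachLetter_letter (hk : .eachLetter c :: k ∈ S) (hi : i < w.length)
    (hnext : Ready R w B y k₀ (c :: .eachLetter c :: k) ρ (i + 2) out) :
    Ready R w B y k₀ (.eachLetter c :: k) ρ (i + 1) out :=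
  of_instruction hk (k' := c :: .eachLetter c :: k) (d := .right) (o := none)
    (fun _ => by simp [readInput, hi, instruction]) (by simpa [TapeMove.apply, hi] using hnext)

theorem eachLetter_rightEnd (hk : .eachLetter c :: k ∈ S)
    (hnext : Ready R w B y k₀ k ρ (w.length + 1) out) :
    Ready R w B y k₀ (.eachLetter c :: k) ρ (w.length + 1) out :=
  of_instruction hk (k' := k) (d := .stay) (o := none) (fun _ => by simp [readInput, instruction])
    (by simpa [TapeMove.apply] using hnext)

end Ready

end Interpreter

section Runs

variable {σ : Type} {R : ℕ} {w : List Unit} {B : ℕ} {ρ ρ' ρ'' : ℕ → ℕ} {i i' i'' r s : ℕ}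
  {c d : Cmd σ} {o o' : List σ}

/-- The command `c` changes the registers `ρ` into `ρ'`, moves the input head from `i` to `i'` and
emits `o`. -/
def Runs (R : ℕ) (w : List Unit) (B : ℕ) (c : Cmd σ) (ρ : ℕ → ℕ) (i : ℕ) (o : List σ)
    (ρ' : ℕ → ℕ) (i' : ℕ) : Prop :=
  ∀ (S : Set (List (Cmd σ))) [Finite S] (k₀ : S) (k : List (Cmd σ)), c.continuations k ⊆ S →
    k ∈ S → ∀ out y, Ready R w B y k₀ k ρ' i' (out ++ o) → Ready R w B y k₀ (c :: k) ρ i out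

namespace Runs

theorem emit (x : σ) (hi : i ≤ w.length + 1) : Runs R w B (.emit x) ρ i [x] ρ i :=
  fun _ _ _ _ hS _ _ _ hnext => Ready.emit (hS (Cmd.cons_mem_continuations _ _)) hi hnext

theorem inc (hr : r < R) (hi : i ≤ w.length + 1) (hlt : ρ r + 1 < 2 ^ B) :
    Runs (σ := σ) R w B (.inc r) ρ i [] (Function.update ρ r (ρ r + 1)) i :=
  fun _ _ _ _ hS _ _ _ hnext =>
    Ready.inc hr (hS (Cmd.cons_mem_continuations _ _)) hi hlt (by simpa using hnext)

theorem clear (r : ℕ) (hi : i ≤ w.length + 1) :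
    Runs (σ := σ) R w B (.clear r) ρ i [] (Function.update ρ r 0) i :=
  fun _ _ _ _ hS _ _ _ hnext =>
    Ready.clear (hS (Cmd.cons_mem_continuations _ _)) hi (by simpa using hnext)

theorem seq (hi : i ≤ w.length + 1) (hc : Runs R w B c ρ i o ρ' i')
    (hd : Runs R w B d ρ' i' o' ρ'' i'') : Runs R w B (.seq c d) ρ i (o ++ o') ρ'' i'' := by
  intro S _ k₀ k hS hk out y hnext
  have hcS : c.continuations (d :: k) ⊆ S := fun x hx => hS (Or.inr (Or.inl hx))
  have hdS : d.continuations k ⊆ S := fun x hx => hS (Or.inr (Or.inr hx))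
  refine Ready.seq (hS (Cmd.cons_mem_continuations _ _)) hi ?_
  exact hc S k₀ _ hcS (hdS (Cmd.cons_mem_continuations _ _)) _ _
    (hd S k₀ _ hdS hk _ _ (by simpa using hnext))

theorem ite (hr : r < R) (hs : s < R) (hi : i ≤ w.length + 1)
    (h : Runs R w B (if ρ r < ρ s then c else d) ρ i o ρ' i') :
    Runs R w B (.ite r s c d) ρ i o ρ' i' := by
  intro S _ k₀ k hS hk out y hnext
  refine Ready.ite hr hs (hS (Cmd.cons_mem_continuations _ _)) hi (h S k₀ k ?_ hk out y hnext)
  split_ifs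
  · exact fun x hx => hS (Or.inr (Or.inl hx))
  · exact fun x hx => hS (Or.inr (Or.inr hx))

theorem whileLt_of_lt (hr : r < R) (hs : s < R) (hi : i ≤ w.length + 1) (hlt : ρ r < ρ s)
    (hc : Runs R w B c ρ i o ρ' i') (h : Runs R w B (.whileLt r s c) ρ' i' o' ρ'' i'') :
    Runs R w B (.whileLt r s c) ρ i (o ++ o') ρ'' i'' := by
  intro S _ k₀ k hS hk out y hnext
  refine Ready.whileLt hr hs (hS (Cmd.cons_mem_continuations _ _)) hi ?_
  rw [if_pos hlt]
  exact hc S k₀ _ (fun x hx => hS (Or.inr hx)) (hS (Cmd.cons_mem_continuations _ _)) _ _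
    (h S k₀ k hS hk _ _ (by simpa using hnext))

theorem whileLt_of_not_lt (hr : r < R) (hs : s < R) (hi : i ≤ w.length + 1)
    (hlt : ¬ ρ r < ρ s) : Runs R w B (.whileLt r s c) ρ i [] ρ i := by
  intro S _ k₀ k hS _ out y hnext
  refine Ready.whileLt hr hs (hS (Cmd.cons_mem_continuations _ _)) hi ?_
  rw [if_neg hlt]
  simpa using hnext

theorem eachLetter_leftEnd (h : Runs R w B (.eachLetter c) ρ 1 o ρ' i') :
    Runs R w B (.eachLetter c) ρ 0 o ρ' i' := by
  intro S _ k₀ k hS hk out y hnext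
  exact Ready.eachLetter_leftEnd (hS (Cmd.cons_mem_continuations _ _)) (h S k₀ k hS hk out y hnext)

theorem eachLetter_letter (hi : i < w.length) (hc : Runs R w B c ρ (i + 2) o ρ' i')
    (h : Runs R w B (.eachLetter c) ρ' i' o' ρ'' i'') :
    Runs R w B (.eachLetter c) ρ (i + 1) (o ++ o') ρ'' i'' := by
  intro S _ k₀ k hS hk out y hnext
  refine Ready.eachLetter_letter (hS (Cmd.cons_mem_continuations _ _)) hi ?_
  exact hc S k₀ _ (fun x hx => hS (Or.inr hx)) (hS (Cmd.cons_mem_continuations _ _)) _ _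
    (h S k₀ k hS hk _ _ (by simpa using hnext))

theorem eachLetter_rightEnd :
    Runs R w B (.eachLetter c) ρ (w.length + 1) [] ρ (w.length + 1) := by
  intro S _ k₀ k hS _ out y hnext
  exact Ready.eachLetter_rightEnd (hS (Cmd.cons_mem_continuations _ _)) (by simpa using hnext)

end Runs

end Runs

/-! ### Strings that counter programs generate -/

section Generable

variable {σ : Type}

/-- The command `c` emits `o`, keeps the registers below `s`, and puts the input head back. -/
def Prints (R : ℕ) (w : List Unit) (B s : ℕ) (c : Cmd σ) (ρ : ℕ → ℕ) (i : ℕ) (o : List σ) : Prop :=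
  ∃ ρ₁ : ℕ → ℕ, Set.EqOn ρ₁ ρ (Set.Iio s) ∧ (∀ r, ρ₁ r < 2 ^ B) ∧ Runs R w B c ρ i o ρ₁ i

/-- The string `f v` is emitted by a program that finds the values of the variables `v` in any
registers `loc`, and that keeps the registers below any given bound `s`. -/
def Generable {ι : Type} (f : (ι → ℕ) → List σ) : Prop :=
  ∀ (loc : ι → ℕ) (s : ℕ), (∀ a, loc a < s) → ∃ (c : Cmd σ) (R₀ : ℕ), ∀ R ≥ R₀,
    ∀ (w : List Unit) (B i : ℕ) (ρ : ℕ → ℕ), i ≤ w.length + 1 → (∀ r, ρ r < 2 ^ B) →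
      Prints R w B s c ρ i (f (ρ ∘ loc))

theorem update_lt_two_pow {B : ℕ} {ρ : ℕ → ℕ} (h : ∀ r, ρ r < 2 ^ B) {r v : ℕ} (hv : v < 2 ^ B)
    (q : ℕ) : Function.update ρ r v q < 2 ^ B := by
  rcases eq_or_ne q r with rfl | hne
  · simpa using hv
  · rw [Function.update_of_ne hne]
    exact h q

theorem eqOn_update_Iio (ρ : ℕ → ℕ) (s v : ℕ) :
    Set.EqOn (Function.update ρ s v) ρ (Set.Iio s) :=
  fun _ hr => Function.update_of_ne (ne_of_lt hr) _ _

theorem exists_runs_whileLt {R : ℕ} {w : List Unit} {B i s r : ℕ} {c : Cmd σ} {ρ : ℕ → ℕ}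
    {g : ℕ → List σ} (hr : r < s) (hs : s < R) (hi : i ≤ w.length + 1) (hρ : ρ r < 2 ^ B)
    (hc : ∀ ρ₁, Set.EqOn ρ₁ ρ (Set.Iio s) → (∀ r, ρ₁ r < 2 ^ B) →
      Prints R w B (s + 1) c ρ₁ i (g (ρ₁ s)))
    {e : ℕ} {ρ₁ : ℕ → ℕ} (he : ρ₁ s + e = ρ r) (hsame : Set.EqOn ρ₁ ρ (Set.Iio s))
    (hbound : ∀ r, ρ₁ r < 2 ^ B) :
    ∃ ρ', Set.EqOn ρ' ρ (Set.Iio s) ∧ (∀ r, ρ' r < 2 ^ B) ∧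
      Runs R w B (.whileLt s r (.seq c (.inc s))) ρ₁ i ((List.range' (ρ₁ s) e).flatMap g) ρ' i := by
  have hr₁ : ρ₁ r = ρ r := hsame hr
  induction e generalizing ρ₁ with
  | zero =>
    exact ⟨ρ₁, hsame, hbound, Runs.whileLt_of_not_lt hs (hr.trans hs) hi (by omega)⟩
  | succ e ih =>
    obtain ⟨ρ₂, hsame₂, hbound₂, hrun⟩ := hc ρ₁ hsame hbound
    have hs₂ : ρ₂ s = ρ₁ s := hsame₂ s.lt_succ_self
    set ρ₃ := Function.update ρ₂ s (ρ₂ s + 1) with hρ₃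
    have hs₃ : ρ₃ s = ρ₁ s + 1 := by simp [hρ₃, hs₂]
    have hsame₃ : Set.EqOn ρ₃ ρ (Set.Iio s) := (eqOn_update_Iio _ _ _).trans
      ((hsame₂.mono (Set.Iio_subset_Iio s.le_succ)).trans hsame)
    obtain ⟨ρ', hsame', hbound', hloop⟩ := ih (by omega) hsame₃
      (update_lt_two_pow hbound₂ (by omega)) (hsame₃ hr)
    refine ⟨ρ', hsame', hbound', ?_⟩
    have := Runs.whileLt_of_lt hs (hr.trans hs) hi (by omega)
      (hrun.seq hi (Runs.inc hs hi (by omega))) hloop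
    simpa [List.range'_succ, hs₃] using this

namespace Generable

variable {ι κ : Type} {f g : (ι → ℕ) → List σ}

theorem congr (hf : Generable f) (h : ∀ v, g v = f v) : Generable g := by
  rwa [funext h]

theorem nil : Generable fun _ : ι → ℕ => ([] : List σ) :=
  fun _ s _ => ⟨.clear s, 0, fun _ _ _ _ _ ρ hi hρ => ⟨_, eqOn_update_Iio ρ s 0,
    update_lt_two_pow hρ (Nat.two_pow_pos _), Runs.clear s hi⟩⟩

theorem emit (x : σ) : Generable fun _ : ι → ℕ => [x] :=
  fun _ _ _ => ⟨.emit x, 0, fun _ _ _ _ _ ρ hi hρ =>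
    ⟨ρ, Set.eqOn_refl _ _, hρ, Runs.emit x hi⟩⟩

theorem append (hf : Generable f) (hg : Generable g) : Generable fun v => f v ++ g v := by
  intro loc s hloc
  obtain ⟨c, R₀, hc⟩ := hf loc s hloc
  obtain ⟨d, R₁, hd⟩ := hg loc s hloc
  refine ⟨.seq c d, max R₀ R₁, fun R hR w B i ρ hi hρ => ?_⟩
  obtain ⟨ρ₁, hsame₁, hbound₁, hrun₁⟩ := hc R (le_of_max_le_left hR) w B i ρ hi hρ
  obtain ⟨ρ₂, hsame₂, hbound₂, hrun₂⟩ := hd R (le_of_max_le_right hR) w B i ρ₁ hi hbound₁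
  have hv : ρ₁ ∘ loc = ρ ∘ loc := funext fun a => hsame₁ (hloc a)
  exact ⟨ρ₂, hsame₂.trans hsame₁, hbound₂, hrun₁.seq hi (hv ▸ hrun₂)⟩

theorem cons (x : σ) (hf : Generable f) : Generable fun v => x :: f v :=
  (emit x).append hf

theorem comap {f : (κ → ℕ) → List σ} (hf : Generable f) (φ : κ → ι) :
    Generable fun v : ι → ℕ => f (v ∘ φ) :=
  fun loc s hloc => hf (loc ∘ φ) s fun a => hloc (φ a)

theorem ite (hf : Generable f) (hg : Generable g) (a b : ι) :
    Generable fun v => if v a < v b then f v else g v := by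
  intro loc s hloc
  obtain ⟨c, R₀, hc⟩ := hf loc s hloc
  obtain ⟨d, R₁, hd⟩ := hg loc s hloc
  refine ⟨.ite (loc a) (loc b) c d, max s (max R₀ R₁), fun R hR w B i ρ hi hρ => ?_⟩
  simp only [ge_iff_le, max_le_iff] at hR
  suffices Prints R w B s (if ρ (loc a) < ρ (loc b) then c else d) ρ i
      (if ρ (loc a) < ρ (loc b) then f (ρ ∘ loc) else g (ρ ∘ loc)) by
    obtain ⟨ρ', hsame, hbound, hrun⟩ := this
    exact ⟨ρ', hsame, hbound,
      Runs.ite ((hloc a).trans_le hR.1) ((hloc b).trans_le hR.1) hi hrun⟩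
  split_ifs
  · exact hc R hR.2.1 w B i ρ hi hρ
  · exact hd R hR.2.2 w B i ρ hi hρ

theorem flatMap {f : (Option ι → ℕ) → List σ} (hf : Generable f) (a : ι) :
    Generable fun v : ι → ℕ => (List.range (v a)).flatMap fun x => f fun o => o.elim x v := by
  intro loc s hloc
  obtain ⟨c, R₀, hc⟩ := hf (fun o => o.elim s loc) (s + 1) (by
    rintro (_ | b)
    exacts [s.lt_succ_self, (hloc b).trans s.lt_succ_self])
  refine ⟨.seq (.clear s) (.whileLt s (loc a) (.seq c (.inc s))), max (s + 1) R₀,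
    fun R hR w B i ρ hi hρ => ?_⟩
  have hbody (ρ₁ : ℕ → ℕ) (hsame : Set.EqOn ρ₁ ρ (Set.Iio s)) (hbound : ∀ r, ρ₁ r < 2 ^ B) :
      Prints R w B (s + 1) c ρ₁ i (f fun o => o.elim (ρ₁ s) (ρ ∘ loc)) := by
    convert hc R (le_of_max_le_right hR) w B i ρ₁ hi hbound using 2
    funext o
    cases o with
    | none => rfl
    | some b => exact (hsame (hloc b)).symm
  have hclear : Function.update ρ s 0 s = 0 := Function.update_self ..
  obtain ⟨ρ', hsame, hbound, hrun⟩ := exists_runs_whileLt (hloc a) (le_of_max_le_left hR) hi (hρ _)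
    (g := fun x => f fun o => o.elim x (ρ ∘ loc)) hbody (e := ρ (loc a)) (by rw [hclear, zero_add])
    (eqOn_update_Iio ρ s 0) (update_lt_two_pow hρ (Nat.two_pow_pos _))
  rw [hclear, ← List.range_eq_range'] at hrun
  exact ⟨ρ', hsame, hbound, (Runs.clear s hi).seq hi hrun⟩

end Generable

end Generable

/-- The registers after `j` letters of the input have been read: the integral square root of `j` in
register `1`, its double in register `3`, and `j` minus its square in register `2`. -/
structure Scanned (B j : ℕ) (ρ : ℕ → ℕ) : Prop where
  count : ρ 0 = j
  square : ρ 1 * ρ 1 + ρ 2 = j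
  double : ρ 3 = 2 * ρ 1
  le : ρ 2 ≤ ρ 3
  bound : ∀ r, ρ r < 2 ^ B

theorem Scanned.sqrt_eq {B j : ℕ} {ρ : ℕ → ℕ} (h : Scanned B j ρ) : ρ 1 = j.sqrt := by
  obtain ⟨-, hsquare, hdouble, hle, -⟩ := h
  exact Nat.eq_sqrt.2 ⟨by omega, by linarith⟩

section Logspace

variable {σ : Type}

/-- Count one more letter, keeping the integral square root up to date. -/
def scanLetter : Cmd σ :=
  .seq (.inc 0) (.ite 2 3 (.inc 2)
    (.seq (.inc 1) (.seq (.inc 3) (.seq (.inc 3) (.clear 2)))))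

theorem Scanned.exists_runs {R : ℕ} (hR : 4 ≤ R) {w : List Unit} {B i j : ℕ} {ρ : ℕ → ℕ}
    (h : Scanned B j ρ) (hi : i ≤ w.length + 1) (hj : j + 3 < 2 ^ B) :
    ∃ ρ', Scanned B (j + 1) ρ' ∧ Runs (σ := σ) R w B scanLetter ρ i [] ρ' i := by
  obtain ⟨hcount, hsquare, hdouble, hle, hbound⟩ := h
  have hroot : 2 * ρ 1 ≤ ρ 1 * ρ 1 + 1 := by nlinarith [sq_nonneg ((ρ 1 : ℤ) - 1)]
  have inc_of {ρ' : ℕ → ℕ} {r : ℕ} (hr : r < 4) (h : ρ' r + 1 < 2 ^ B) :=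
    Runs.inc (σ := σ) (ρ := ρ') (hr.trans_le hR) hi h
  set ρ₁ := Function.update ρ 0 (ρ 0 + 1) with hρ₁
  have hrun₁ : Runs (σ := σ) R w B (.inc 0) ρ i [] ρ₁ i := inc_of (by omega) (by omega)
  have hbound₁ : ∀ r, ρ₁ r < 2 ^ B := update_lt_two_pow hbound (by omega)
  have h₁ : ρ₁ 1 = ρ 1 ∧ ρ₁ 2 = ρ 2 ∧ ρ₁ 3 = ρ 3 := by simp [hρ₁]
  suffices ∃ ρ', Scanned B (j + 1) ρ' ∧ Runs (σ := σ) R w B (if ρ₁ 2 < ρ₁ 3 then .inc 2 else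
      .seq (.inc 1) (.seq (.inc 3) (.seq (.inc 3) (.clear 2)))) ρ₁ i [] ρ' i by
    obtain ⟨ρ', hρ', hrun⟩ := this
    exact ⟨ρ', hρ', hrun₁.seq hi (Runs.ite (by omega) (by omega) hi hrun)⟩
  split_ifs with hlt
  · refine ⟨_, ?_, inc_of (by omega) (by omega)⟩
    refine ⟨by simp [hρ₁, hcount], ?_, ?_, ?_, update_lt_two_pow hbound₁ (by omega)⟩ <;>
      simp [hρ₁] <;> omega
  · set ρ₂ := Function.update ρ₁ 1 (ρ₁ 1 + 1) with hρ₂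
    set ρ₃ := Function.update ρ₂ 3 (ρ₂ 3 + 1) with hρ₃
    set ρ₄ := Function.update ρ₃ 3 (ρ₃ 3 + 1) with hρ₄
    have h₃ : ρ₂ 3 = ρ 3 ∧ ρ₃ 3 = ρ 3 + 1 := by simp [hρ₁, hρ₂, hρ₃]
    have hrun : Runs (σ := σ) R w B _ ρ₁ i [] (Function.update ρ₄ 2 0) i :=
      (inc_of (r := 1) (by omega) (by omega)).seq hi
        ((inc_of (ρ' := ρ₂) (r := 3) (by omega) (by omega)).seq hi
        ((inc_of (ρ' := ρ₃) (r := 3) (by omega) (by omega)).seq hi (Runs.clear 2 hi)))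
    refine ⟨_, ?_, hrun⟩
    have hsucc : (ρ 1 + 1) * (ρ 1 + 1) = ρ 1 * ρ 1 + 2 * ρ 1 + 1 := by ring
    refine ⟨by simp [hρ₁, hρ₂, hρ₃, hρ₄, hcount], ?_, ?_, ?_, update_lt_two_pow
      (update_lt_two_pow (update_lt_two_pow (update_lt_two_pow hbound₁ ?_) ?_) ?_) ?_⟩ <;>
      simp [hρ₁, hρ₂, hρ₃, hρ₄] <;> omega

theorem Scanned.exists_runs_eachLetter {R : ℕ} (hR : 4 ≤ R) {w : List Unit} {B : ℕ}
    (hB : w.length + 3 < 2 ^ B) {j : ℕ} (hj : j ≤ w.length) {ρ : ℕ → ℕ} (hρ : Scanned B j ρ) :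
    ∃ ρ', Scanned B w.length ρ' ∧
      Runs (σ := σ) R w B (.eachLetter scanLetter) ρ (j + 1) [] ρ' (w.length + 1) := by
  induction hj using Nat.decreasingInduction generalizing ρ with
  | self => exact ⟨ρ, hρ, Runs.eachLetter_rightEnd⟩
  | of_succ j hj ih =>
    obtain ⟨ρ₁, hρ₁, hletter⟩ := hρ.exists_runs hR (w := w) (i := j + 2) (by omega) (by omega)
    obtain ⟨ρ', hρ', hrest⟩ := ih hρ₁
    exact ⟨ρ', hρ', Runs.eachLetter_letter hj hletter hrest⟩

theorem Generable.exists_runs {f : (Bool → ℕ) → List σ} (hf : Generable f) :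
    ∃ (c : Cmd σ) (R : ℕ), ∀ (w : List Unit) (B : ℕ), w.length + 3 < 2 ^ B → ∃ ρ' i',
      Runs R w B c (fun _ => 0) 0 (f fun b => cond b w.length w.length.sqrt) ρ' i' := by
  obtain ⟨c, R₀, hc⟩ := hf (fun b => cond b 0 1) 2 (by simp)
  refine ⟨.seq (.eachLetter scanLetter) c, max 4 R₀, fun w B hB => ?_⟩
  have hstart : Scanned B 0 fun _ => 0 := ⟨rfl, rfl, rfl, le_rfl, fun _ => Nat.two_pow_pos _⟩
  obtain ⟨ρ, hρ, hscan⟩ := hstart.exists_runs_eachLetter (σ := σ) (le_max_left 4 R₀) hB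
    (Nat.zero_le _)
  obtain ⟨ρ', -, -, hrun⟩ := hc _ (le_max_right _ _) w B _ ρ le_rfl hρ.bound
  have hv : (ρ ∘ fun b => cond b 0 1) = fun b => cond b w.length w.length.sqrt := by
    funext b
    cases b
    exacts [hρ.sqrt_eq, hρ.count]
  exact ⟨ρ', _, (Runs.eachLetter_leftEnd hscan).seq (Nat.zero_le _) (hv ▸ hrun)⟩

theorem Runs.computesWithin {R : ℕ} {w : List Unit} {B : ℕ} {c : Cmd σ} {o : List σ} {ρ' : ℕ → ℕ}
    {i' : ℕ} {S : Set (List (Cmd σ))} [Finite S] (hS : c.continuations [] ⊆ S) (hnil : [] ∈ S)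
    (h : Runs R w B c (fun _ => 0) 0 o ρ' i') :
    (interpreter R S ⟨[c], hS (c.cons_mem_continuations [])⟩).ComputesWithin w o (B + 2) := by
  set k₀ : S := ⟨[c], hS (c.cons_mem_continuations [])⟩
  have hstart : (interpreter R S k₀).startConfig = conf k₀ [c] .init (fun _ => none) 0 0 [] := by
    have hclamp : clamp k₀ [c] = k₀ := dif_pos k₀.2
    simp only [Transducer.startConfig, conf, interpreter, hclamp]
  have hready : Ready R w B o k₀ [c] (fun _ => 0) 0 [] := by
    refine h S k₀ [] hS hnil [] o fun T _ => ?_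
    exact Transducer.HaltsWithin.of_next_eq_none (by rw [next_conf hnil]; rfl)
      (fun _ => by simp [conf])
  have hempty : Holds (R := R) B (fun _ => 0) (Function.update (fun _ => none) 0 (some none)) := by
    refine ⟨0, by omega, by simp, funext fun j => ?_⟩
    cases j <;> simp [tapeOf]
  have := haltsWithin_conf (y := o) k₀.2 (p := .init) (w := w) (T := fun _ => none) (h := 0)
    (i := 0) (out := []) (q := ([c], .ready)) (d := .stay) (x := some none) (d' := .stay)
    (o := none) rfl (by omega) (by simpa [TapeMove.apply] using hready _ hempty)
  rwa [← hstart] at this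

theorem Generable.logspace {f : (Bool → ℕ) → List σ} (hf : Generable f) :
    ∃ (M : Transducer Unit σ) (c : ℕ), ∀ m : ℕ, M.ComputesWithin (List.replicate m ())
      (f fun b => cond b m m.sqrt) (c * (Nat.log 2 m + 1)) := by
  obtain ⟨c, R, hc⟩ := hf.exists_runs
  set S : Set (List (Cmd σ)) := insert [] (c.continuations [])
  have : Finite S := ((c.finite_continuations []).insert []).to_subtype
  have hS : c.continuations [] ⊆ S := Set.subset_insert _ _
  refine ⟨interpreter R S ⟨[c], hS (c.cons_mem_continuations [])⟩, 6, fun m => ?_⟩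
  have hlength : (List.replicate m ()).length = m := List.length_replicate
  have hB : m + 3 < 2 ^ (Nat.log 2 m + 4) := by
    have := Nat.lt_pow_succ_log_self one_lt_two m
    simp only [pow_succ] at this ⊢
    omega
  obtain ⟨ρ', i', hrun⟩ := hc (List.replicate m ()) (Nat.log 2 m + 4) (by rwa [hlength])
  rw [hlength] at hrun
  obtain ⟨hcomputes, hspace⟩ := hrun.computesWithin hS (Set.mem_insert _ _)
  exact ⟨hcomputes, fun d hd j => (hspace d hd j).trans_le (by omega)⟩

end Logspace

/-- The number `a v` can be written down in unary. -/
abbrev TickGenerable {ι : Type} (a : (ι → ℕ) → ℕ) : Prop :=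
  Generable fun v => List.replicate (a v) CircuitSymbol.tick

namespace TickGenerable

variable {ι : Type} {a b : (ι → ℕ) → ℕ}

theorem zero : TickGenerable fun _ : ι → ℕ => 0 := Generable.nil

theorem one : TickGenerable fun _ : ι → ℕ => 1 := Generable.emit _

theorem add (ha : TickGenerable a) (hb : TickGenerable b) : TickGenerable fun v => a v + b v :=
  (Generable.append ha hb).congr fun _ => List.replicate_add ..

theorem mul_var (ha : TickGenerable a) (i : ι) : TickGenerable fun v => a v * v i := by
  refine ((Generable.comap ha some).flatMap i).congr fun v => ?_
  have hv (x : ℕ) : (fun o : Option ι => o.elim x v) ∘ some = v := rfl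
  simp only [hv]
  generalize v i = n
  induction n with
  | zero => rfl
  | succ n ih => rw [List.range_succ, List.flatMap_append, ← ih]; simp [Nat.mul_succ]

theorem mul_pow_var (ha : TickGenerable a) (i : ι) (e : ℕ) :
    TickGenerable fun v => a v * v i ^ e := by
  induction e with
  | zero => simpa using ha
  | succ e ih => simpa only [pow_succ, ← mul_assoc] using ih.mul_var i

theorem pow_var (i : ι) (e : ℕ) : TickGenerable fun v => v i ^ e := by
  simpa using one.mul_pow_var i e

theorem var (i : ι) : TickGenerable fun v => v i := by
  simpa using pow_var i 1

theorem encodeNode (ha : TickGenerable a) : Generable fun v => encodeNode (a v) :=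
  Generable.append ha (Generable.emit _)

end TickGenerable

/-! ### Layers of gates that are numbered by tuples -/

/-- The number of a tuple over `{0, …, N - 1}`, where the entry `0` is the least significant digit.
This is `finFunctionFinEquiv` without its bounds, as a program sees it. -/
def tupleIndex (N : ℕ) {d : ℕ} (t : Fin d → ℕ) : ℕ := ∑ i, t i * N ^ (i : ℕ)

/-- The tuples over `Fin N` in the order of their numbers. -/
def tuples (N d : ℕ) : List (Fin d → Fin N) := List.ofFn finFunctionFinEquiv.symm

section Tuples

variable {N d e : ℕ}

theorem tupleIndex_coe (t : Fin d → Fin N) :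
    tupleIndex N (fun i => (t i : ℕ)) = finFunctionFinEquiv t := rfl

theorem tupleIndex_lt (t : Fin d → Fin N) : tupleIndex N (fun i => (t i : ℕ)) < N ^ d :=
  (finFunctionFinEquiv t).isLt

theorem length_tuples (N d : ℕ) : (tuples N d).length = N ^ d := List.length_ofFn

theorem mem_tuples (t : Fin d → Fin N) : t ∈ tuples N d :=
  List.mem_ofFn.2 ⟨finFunctionFinEquiv t, Equiv.symm_apply_apply _ t⟩

theorem getElem?_tuples (t : Fin d → Fin N) :
    (tuples N d)[tupleIndex N fun i => (t i : ℕ)]? = some t := by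
  rw [tuples, tupleIndex_coe, List.getElem?_ofFn, dif_pos (finFunctionFinEquiv t).isLt]
  exact congrArg some (Equiv.symm_apply_apply _ t)

theorem countP_tuples (p : (Fin d → Fin N) → Bool) :
    (tuples N d).countP p = (Finset.univ.filter fun t => p t = true).card := by
  have hnodup : (tuples N d).Nodup := List.nodup_ofFn.2 finFunctionFinEquiv.symm.injective
  rw [List.countP_eq_length_filter, ← List.toFinset_card_of_nodup (hnodup.filter _)]
  congr 1
  ext t
  simp [mem_tuples]

theorem tuples_zero (N : ℕ) : tuples N 0 = [Fin.elim0] := by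
  refine List.ext_getElem (by simp [length_tuples]) fun i _ _ => Subsingleton.elim _ _

theorem tuples_succ (N d : ℕ) :
    tuples N (d + 1) =
      (tuples N d).flatMap fun t => (List.finRange N).map fun x => Fin.cons x t := by
  have hindex (i : Fin (N ^ d)) (x : Fin N) (h : i * N + x < N ^ (d + 1)) :
      finFunctionFinEquiv.symm ⟨i * N + x, h⟩ =
        (Fin.cons x (finFunctionFinEquiv.symm i) : Fin (d + 1) → Fin N) := by
    rw [Equiv.symm_apply_eq, Fin.ext_iff, finFunctionFinEquiv_apply_val, Fin.sum_univ_succ]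
    have hi := congrArg Fin.val (Equiv.apply_symm_apply finFunctionFinEquiv i)
    rw [finFunctionFinEquiv_apply_val] at hi
    simp only [Fin.cons_zero, Fin.cons_succ, Fin.val_zero, pow_zero, mul_one, Fin.val_succ,
      pow_succ, ← mul_assoc, ← Finset.sum_mul, hi]
    exact add_comm _ _
  rw [tuples, tuples, List.ofFn_congr (pow_succ N d), List.ofFn_mul, List.flatMap_def,
    List.map_ofFn]
  congr 2
  funext i
  rw [Function.comp_apply, ← List.ofFn_eq_map]
  exact congrArg List.ofFn (funext fun x => hindex i x _)

end Tuples

section Generable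

variable {σ ι : Type}

theorem Generable.flatMap_tuples {e : ℕ} {f : (ι ⊕ Fin e → ℕ) → List σ} (hf : Generable f)
    (a : ι) : Generable fun v : ι → ℕ =>
      (tuples (v a) e).flatMap fun t => f (Sum.elim v fun k => (t k : ℕ)) := by
  induction e with
  | zero =>
    refine (hf.comap (Sum.elim id Fin.elim0)).congr fun v => ?_
    rw [tuples_zero, List.flatMap_singleton]
    congr 1
    funext s
    rcases s with b | k
    exacts [rfl, k.elim0]
  | succ e ih =>
    let φ : ι ⊕ Fin (e + 1) → Option (ι ⊕ Fin e) :=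
      Sum.elim (fun b => some (.inl b)) (Fin.cons none fun k => some (.inr k))
    refine (ih ((hf.comap φ).flatMap (.inl a))).congr fun v => ?_
    rw [tuples_succ, List.flatMap_assoc]
    congr 1
    funext t
    rw [List.flatMap_map, Sum.elim_inl, ← List.map_coe_finRange_eq_range, List.flatMap_map]
    congr 1
    funext x
    congr 1
    funext s
    rcases s with b | k
    · rfl
    · refine Fin.cases rfl (fun k => ?_) k
      simp [φ]

theorem Generable.flatMap_list {β : Type*} {l : List β} {f : β → (ι → ℕ) → List σ}
    (h : ∀ b ∈ l, Generable (f b)) : Generable fun v => l.flatMap fun b => f b v := by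
  induction l with
  | nil => exact Generable.nil
  | cons b l ih =>
    exact (h b List.mem_cons_self).append (ih fun c hc => h c (List.mem_cons_of_mem _ hc))

theorem TickGenerable.sum {d : ℕ} {a : Fin d → (ι → ℕ) → ℕ} (h : ∀ i, TickGenerable (a i)) :
    TickGenerable fun v => ∑ i, a i v := by
  induction d with
  | zero => exact TickGenerable.zero
  | succ d ih =>
    simp only [Fin.sum_univ_succ]
    exact (h 0).add (ih fun i => h i.succ)

theorem TickGenerable.tupleIndex {d : ℕ} (a : ι) (φ : Fin d → ι) :
    TickGenerable fun v => tupleIndex (v a) (v ∘ φ) :=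
  TickGenerable.sum fun i => (TickGenerable.var (φ i)).mul_pow_var a i

end Generable

/-- The values of all nodes of the circuit with the gates `g` on the input `x`. -/
abbrev values (g : List Gate) (x : List Bool) : List Bool := Circuit.nodeValues ⟨g, []⟩ x

/-- The depths of all nodes of the circuit with the gates `g` on `m` inputs. -/
abbrev depths (m : ℕ) (g : List Gate) : List ℕ := Circuit.nodeDepths m ⟨g, []⟩

section Values

variable {α β : Type*}

theorem isPrefix_foldl_concat (F : List α → β → α) (l : List β) (v : List α) :
    v <+: l.foldl (fun v b => v ++ [F v b]) v := by
  induction l generalizing v with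
  | nil => exact List.prefix_rfl
  | cons b l ih => exact (List.prefix_append _ _).trans (ih _)

theorem length_foldl_concat (F : List α → β → α) (l : List β) (v : List α) :
    (l.foldl (fun v b => v ++ [F v b]) v).length = v.length + l.length := by
  induction l generalizing v with
  | nil => rfl
  | cons b l ih => rw [List.foldl_cons, ih, List.length_append, List.length_cons]; grind

theorem foldl_concat_eq_append (F : List α → β → α) (v : List α) {l : List β}
    (h : ∀ b ∈ l, ∀ u, F (v ++ u) b = F v b) (u : List α) :
    l.foldl (fun v b => v ++ [F v b]) (v ++ u) = v ++ u ++ l.map (F v) := by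
  induction l generalizing u with
  | nil => simp
  | cons b l ih =>
    rw [List.foldl_cons, h b List.mem_cons_self, List.append_assoc,
      ih fun c hc => h c (List.mem_cons_of_mem _ hc)]
    simp

theorem getD_eq_of_isPrefix {v u : List α} (h : v <+: u) {a : ℕ} (ha : a < v.length) (z : α) :
    u.getD a z = v.getD a z := by
  obtain ⟨w, rfl⟩ := h
  exact List.getD_append _ _ _ _ ha

theorem length_values (g : List Gate) (x : List Bool) :
    (values g x).length = x.length + g.length :=
  length_foldl_concat (fun v (b : Gate) => b.value v) g x

theorem isPrefix_values (g : List Gate) (x : List Bool) : x <+: values g x :=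
  isPrefix_foldl_concat (fun v (b : Gate) => b.value v) g x

theorem values_mono {g g' : List Gate} (h : g <+: g') (x : List Bool) :
    values g x <+: values g' x := by
  obtain ⟨l, rfl⟩ := h
  simp only [values, Circuit.nodeValues, List.foldl_append]
  exact isPrefix_foldl_concat (fun v b => Gate.value b v) l _

theorem length_depths (m : ℕ) (g : List Gate) : (depths m g).length = m + g.length := by
  refine (length_foldl_concat (fun (ds : List ℕ) (g : Gate) =>
    (g.args.map fun a => ds.getD a 0).foldr max 0 + 1) g (List.replicate m 0)).trans ?_
  rw [List.length_replicate]

/-- The Boolean function of a gate type, on the list of its arguments. -/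
def GateKind.eval : GateKind → List Bool → Bool
  | .and, bits => bits.all id
  | .or, bits => bits.any id
  | .not, bits => !bits.headD false
  | .maj, bits => decide (bits.length ≤ 2 * bits.countP id)

theorem Gate.value_eq_eval {γ : Gate} (hnot : γ.kind = .not → γ.args.length = 1)
    (v : List Bool) : γ.value v = γ.kind.eval (γ.args.map fun a => v.getD a false) := by
  rcases γ with ⟨κ, args⟩
  cases κ with
  | and => simp [Gate.value, GateKind.eval]
  | or => simp [Gate.value, GateKind.eval]
  | not =>
    obtain ⟨a, rfl⟩ := List.length_eq_one_iff.1 (hnot rfl)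
    rfl
  | maj => simp [Gate.value, GateKind.eval, List.countP_map]

theorem values_append_layer {g l : List Gate} {x : List Bool}
    (hargs : ∀ γ ∈ l, ∀ a ∈ γ.args, a < x.length + g.length)
    (hnot : ∀ γ ∈ l, γ.kind = .not → γ.args.length = 1) :
    values (g ++ l) x = values g x ++ l.map fun γ => γ.value (values g x) := by
  have hvalue (γ : Gate) (hγ : γ ∈ l) (u : List Bool) :
      γ.value (values g x ++ u) = γ.value (values g x) := by
    rw [Gate.value_eq_eval (hnot γ hγ), Gate.value_eq_eval (hnot γ hγ)]
    congr 1
    refine List.map_congr_left fun a ha => List.getD_append _ _ _ _ ?_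
    rw [length_values]
    exact hargs γ hγ a ha
  simpa [values, Circuit.nodeValues] using
    foldl_concat_eq_append (fun v (b : Gate) => b.value v) (values g x) hvalue []

theorem foldr_max_le {l : List ℕ} {D : ℕ} (h : ∀ x ∈ l, x ≤ D) : l.foldr max 0 ≤ D := by
  induction l with
  | nil => simp
  | cons a l ih =>
    exact max_le (h a List.mem_cons_self) (ih fun x hx => h x (List.mem_cons_of_mem _ hx))

theorem getD_zero_le {l : List ℕ} {D : ℕ} (h : ∀ x ∈ l, x ≤ D) (a : ℕ) : l.getD a 0 ≤ D := by
  rcases lt_or_ge a l.length with ha | ha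
  · rw [List.getD_eq_getElem _ _ ha]
    exact h _ (List.getElem_mem _)
  · rw [List.getD_eq_default _ _ ha]
    exact Nat.zero_le _

theorem depths_append_layer_le {g l : List Gate} {m D : ℕ}
    (hargs : ∀ γ ∈ l, ∀ a ∈ γ.args, a < m + g.length) (hD : ∀ x ∈ depths m g, x ≤ D) :
    ∀ x ∈ depths m (g ++ l), x ≤ D + 1 := by
  let F (ds : List ℕ) (γ : Gate) : ℕ := (γ.args.map fun a => ds.getD a 0).foldr max 0 + 1
  have hF (γ : Gate) (hγ : γ ∈ l) (u : List ℕ) : F (depths m g ++ u) γ = F (depths m g) γ := by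
    refine congrArg (fun ds : List ℕ => ds.foldr max 0 + 1) (List.map_congr_left fun a ha => ?_)
    refine List.getD_append _ _ _ _ ?_
    rw [length_depths]
    exact hargs γ hγ a ha
  have hdepths : depths m (g ++ l) = depths m g ++ l.map (F (depths m g)) := by
    simpa [depths, Circuit.nodeDepths, F] using foldl_concat_eq_append F (depths m g) hF []
  intro x hx
  rw [hdepths, List.mem_append, List.mem_map] at hx
  rcases hx with hx | ⟨γ, -, rfl⟩
  · exact (hD x hx).trans D.le_succ
  · refine Nat.succ_le_succ (foldr_max_le ?_)
    simp only [List.mem_map, forall_exists_index, and_imp, forall_apply_eq_imp_iff₂]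
    exact fun a _ => getD_zero_le hD a

end Values

/-- A uniform family of circuits of polynomial size and constant depth on `m` inputs, which depends
on a second number `N` with `N² ≤ m`; majority gates are allowed if `maj` is true. -/
structure IsStage (maj : Bool) (g : ℕ → ℕ → List Gate) : Prop where
  args_lt : ∀ m N, N * N ≤ m → ∀ i γ, (g m N)[i]? = some γ → ∀ a ∈ γ.args, a < m + i
  not_unary : ∀ m N, ∀ γ ∈ g m N, γ.kind = .not → γ.args.length = 1
  noMaj : maj = false → ∀ m N, ∀ γ ∈ g m N, γ.kind ≠ .maj
  size : ∃ c, ∀ m N, N * N ≤ m → (⟨g m N, []⟩ : Circuit).size ≤ (m + 2) ^ c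
  depth : ∃ D, ∀ m N, N * N ≤ m → ∀ x ∈ depths m (g m N), x ≤ D
  length : TickGenerable fun v : Bool → ℕ => (g (v true) (v false)).length
  encode : Generable fun v : Bool → ℕ => (g (v true) (v false)).flatMap Gate.encode

theorem isStage_nil (maj : Bool) : IsStage maj fun _ _ => [] where
  args_lt := by simp
  not_unary := by simp
  noMaj := by simp
  size := ⟨0, by simp [Circuit.size]⟩
  depth := ⟨0, fun m N _ x hx => (List.eq_of_mem_replicate hx).le⟩
  length := Generable.nil
  encode := Generable.nil

/-- The gates `γ m N t`, one for each tuple `t` of length `d`, that read nodes of `g`, can be added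
to the stage `g`. -/
structure IsLayer (maj : Bool) (g : ℕ → ℕ → List Gate) {d : ℕ}
    (γ : ℕ → ℕ → (Fin d → ℕ) → Gate) : Prop where
  args_lt : ∀ m N, N * N ≤ m → ∀ t : Fin d → Fin N, ∀ a ∈ (γ m N fun i => t i).args,
    a < m + (g m N).length
  not_unary : ∀ m N t, (γ m N t).kind = .not → (γ m N t).args.length = 1
  noMaj : maj = false → ∀ m N t, (γ m N t).kind ≠ .maj
  size : ∃ c, ∀ m N, N * N ≤ m → ∀ t, (γ m N t).args.length ≤ (m + 2) ^ c
  encode : Generable fun v : Fin d ⊕ Bool → ℕ =>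
    (γ (v (.inr true)) (v (.inr false)) (v ∘ .inl)).encode

/-- The gates of a layer in the order of their tuples. -/
def layer {d : ℕ} (γ : ℕ → ℕ → (Fin d → ℕ) → Gate) (m N : ℕ) : List Gate :=
  (tuples N d).map fun t => γ m N fun i => t i

section Layer

variable {maj : Bool} {g : ℕ → ℕ → List Gate} {d : ℕ} {γ : ℕ → ℕ → (Fin d → ℕ) → Gate}

theorem length_layer (γ : ℕ → ℕ → (Fin d → ℕ) → Gate) (m N : ℕ) :
    (layer γ m N).length = N ^ d := by
  rw [layer, List.length_map, length_tuples]

theorem forall_mem_layer {m N : ℕ} {p : Gate → Prop}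
    (h : ∀ t : Fin d → Fin N, p (γ m N fun i => t i)) :
    ∀ γ' ∈ layer γ m N, p γ' :=
  List.forall_mem_map.2 fun t _ => h t

theorem pow_add_pow_le_pow {x : ℕ} (hx : 2 ≤ x) (a b : ℕ) : x ^ a + x ^ b ≤ x ^ (a + b + 1) := by
  have ha : x ^ a ≤ x ^ (a + b) := Nat.pow_le_pow_right (by omega) (by omega)
  have hb : x ^ b ≤ x ^ (a + b) := Nat.pow_le_pow_right (by omega) (by omega)
  calc x ^ a + x ^ b ≤ x ^ (a + b) * 2 := by omega
    _ ≤ x ^ (a + b + 1) := by rw [pow_succ]; gcongr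

theorem IsLayer.exists_size_le (hγ : IsLayer maj g γ) :
    ∃ c, ∀ m N, N * N ≤ m → (⟨layer γ m N, []⟩ : Circuit).size ≤ (m + 2) ^ c := by
  obtain ⟨e, he⟩ := hγ.size
  refine ⟨d + (0 + e + 1), fun m N hN => ?_⟩
  have hNm : N ≤ m + 2 := by nlinarith
  have hwires := List.sum_le_card_nsmul ((layer γ m N).map fun g => g.args.length)
    ((m + 2) ^ e) (List.forall_mem_map.2 (forall_mem_layer fun t => he m N hN _))
  rw [List.length_map, length_layer, smul_eq_mul] at hwires
  calc (⟨layer γ m N, []⟩ : Circuit).size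
      ≤ N ^ d * ((m + 2) ^ 0 + (m + 2) ^ e) := by
        rw [Circuit.size, length_layer]; linarith
    _ ≤ (m + 2) ^ (d + (0 + e + 1)) := by
        rw [pow_add]; gcongr; exact pow_add_pow_le_pow (by omega) 0 e

theorem IsStage.append_layer (hg : IsStage maj g) (hγ : IsLayer maj g γ) :
    IsStage maj fun m N => g m N ++ layer γ m N where
  args_lt m N hN i γ' hγ' a ha := by
    rcases lt_or_ge i (g m N).length with hi | hi
    · rw [List.getElem?_append_left hi] at hγ'
      exact hg.args_lt m N hN i γ' hγ' a ha
    · rw [List.getElem?_append_right hi] at hγ'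
      have hlt := forall_mem_layer (p := fun γ' => ∀ a ∈ γ'.args, a < m + (g m N).length)
        (hγ.args_lt m N hN) γ' (List.mem_of_getElem? hγ') a ha
      omega
  not_unary m N := List.forall_mem_append.2
    ⟨hg.not_unary m N, forall_mem_layer fun _ => hγ.not_unary m N _⟩
  noMaj hmaj m N := List.forall_mem_append.2
    ⟨hg.noMaj hmaj m N, forall_mem_layer fun _ => hγ.noMaj hmaj m N _⟩
  size := by
    obtain ⟨a, ha⟩ := hg.size
    obtain ⟨b, hb⟩ := hγ.exists_size_le
    refine ⟨a + b + 1, fun m N hN => le_trans ?_ (pow_add_pow_le_pow (by omega) a b)⟩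
    have hsize := add_le_add (ha m N hN) (hb m N hN)
    simp only [Circuit.size, List.length_append, List.map_append, List.sum_append] at hsize ⊢
    omega
  depth := by
    obtain ⟨D, hD⟩ := hg.depth
    exact ⟨D + 1, fun m N hN =>
      depths_append_layer_le (forall_mem_layer (hγ.args_lt m N hN)) (hD m N hN)⟩
  length := by
    simpa only [List.length_append, length_layer] using
      hg.length.add (TickGenerable.pow_var false d)
  encode := by
    refine (hg.encode.append ((hγ.encode.comap Sum.swap).flatMap_tuples false)).congr fun v => ?_
    rw [List.flatMap_append, layer, List.flatMap_map]
    rfl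

theorem IsLayer.getD_values (hγ : IsLayer maj g γ) {m N : ℕ} (hN : N * N ≤ m) {x : List Bool}
    (hx : x.length = m) (t : Fin d → Fin N) :
    (values (g m N ++ layer γ m N) x).getD (m + (g m N).length + tupleIndex N fun i => (t i : ℕ))
      false = (γ m N fun i => t i).value (values (g m N) x) := by
  rw [values_append_layer (by rw [hx]; exact forall_mem_layer (hγ.args_lt m N hN))
    (forall_mem_layer fun _ => hγ.not_unary m N _), List.getD_eq_getElem?_getD,
    List.getElem?_append_right (by rw [length_values, hx]; omega), length_values, hx,
    Nat.add_sub_cancel_left, layer, List.map_map, List.getElem?_map, getElem?_tuples]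
  rfl

end Layer

/-- A property of tuples of vertices of a graph with the vertices `Fin N`. -/
abbrev Query (d : ℕ) := ∀ N, (Fin N → Fin N → Prop) → (Fin d → Fin N) → Prop

/-- The relation whose matrix, written row by row, is `x`. -/
def rel (N : ℕ) (x : List Bool) (u v : Fin N) : Prop := x.getD (u * N + v) false = true

/-- The truth values of the query `P` are the values of consecutive nodes, starting at `b m N`. -/
structure ComputesAt (g : ℕ → ℕ → List Gate) {d : ℕ} (P : Query d) (b : ℕ → ℕ → ℕ) : Prop where
  ticks : TickGenerable fun v : Bool → ℕ => b (v true) (v false)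
  lt : ∀ m N, N * N ≤ m → ∀ t : Fin d → Fin N,
    b m N + tupleIndex N (fun i => (t i : ℕ)) < m + (g m N).length
  value : ∀ m N, N * N ≤ m → ∀ x : List Bool, x.length = m → ∀ t : Fin d → Fin N,
    ((values (g m N) x).getD (b m N + tupleIndex N fun i => (t i : ℕ)) false = true ↔
      P N (rel N x) t)

/-- Every stage can be extended to a stage that computes the query `P`. -/
def Definable (maj : Bool) {d : ℕ} (P : Query d) : Prop :=
  ∀ g, IsStage maj g → ∃ g' b, IsStage maj g' ∧ (∀ m N, g m N <+: g' m N) ∧ ComputesAt g' P b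

section Definable

variable {maj : Bool} {g g' : ℕ → ℕ → List Gate} {d : ℕ} {P : Query d} {b : ℕ → ℕ → ℕ}

theorem ComputesAt.mono (h : ComputesAt g P b) (hg : ∀ m N, g m N <+: g' m N) :
    ComputesAt g' P b where
  ticks := h.ticks
  lt m N hN t := (h.lt m N hN t).trans_le (Nat.add_le_add_left (hg m N).length_le m)
  value m N hN x hx t := by
    rw [← h.value m N hN x hx t, getD_eq_of_isPrefix (values_mono (hg m N) x)]
    rw [length_values, hx]
    exact h.lt m N hN t

theorem IsLayer.exists_computesAt {γ : ℕ → ℕ → (Fin d → ℕ) → Gate} (hγ : IsLayer maj g γ)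
    (hg : IsStage maj g)
    (hvalue : ∀ m N, N * N ≤ m → ∀ x : List Bool, x.length = m → ∀ t : Fin d → Fin N,
      ((γ m N fun i => t i).value (values (g m N) x) = true ↔ P N (rel N x) t)) :
    ∃ g' b, IsStage maj g' ∧ (∀ m N, g m N <+: g' m N) ∧ ComputesAt g' P b := by
  refine ⟨fun m N => g m N ++ layer γ m N, fun m N => m + (g m N).length, hg.append_layer hγ,
    fun _ _ => List.prefix_append _ _, (TickGenerable.var true).add hg.length,
    fun m N _ t => ?_, fun m N hN x hx t => ?_⟩
  · rw [List.length_append, length_layer, ← add_assoc]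
    exact Nat.add_lt_add_left (tupleIndex_lt t) _
  · rw [hγ.getD_values hN hx, hvalue m N hN x hx]

end Definable

/-! ### First-order queries and majority -/

namespace IsLayer

variable {maj : Bool} {g : ℕ → ℕ → List Gate} {d : ℕ}

theorem adj (i j : Fin d) : IsLayer maj g fun _ N t => ⟨.or, [t i * N + t j]⟩ where
  args_lt m N hN t a ha := by
    rw [List.mem_singleton.1 ha]
    have := (finProdFinEquiv (t i, t j)).isLt
    rw [finProdFinEquiv_apply_val] at this
    nlinarith
  not_unary := by simp
  noMaj := by simp
  size := ⟨0, by simp⟩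
  encode := by
    refine (Generable.cons (.gate .or) (TickGenerable.encodeNode
      (((TickGenerable.var (.inl i)).mul_var (.inr false)).add
        (TickGenerable.var (.inl j))))).congr fun v => ?_
    simp [Gate.encode]

theorem lt (i j : Fin d) :
    IsLayer maj g fun _ _ t => if t i < t j then ⟨.and, []⟩ else ⟨.or, []⟩ where
  args_lt m N _ t a ha := by split_ifs at ha <;> simp at ha
  not_unary _ _ t h := by split_ifs at h
  noMaj _ _ _ t := by split_ifs <;> simp
  size := ⟨0, fun m N _ t => by split_ifs <;> simp⟩
  encode := by
    refine (Generable.ite (Generable.emit (.gate .and)) (Generable.emit (.gate .or))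
      (.inl i) (.inl j)).congr fun v => ?_
    simp only [Function.comp_apply]
    split_ifs <;> rfl

end IsLayer

theorem apply_append {α β : Type*} (f : α → β) {d e : ℕ} (t : Fin d → α) (s : Fin e → α)
    (i : Fin (d + e)) : f (Fin.append t s i) = Fin.append (f ∘ t) (f ∘ s) i := by
  induction i using Fin.addCases <;> simp

/-- The arguments of a gate that reads the truth values of the queries in `Ps`, with values starting
at `b P`, on all extensions of the tuple `t` by `e` entries. -/
def extensionArgs {d e : ℕ} (Ps : List (Query (d + e))) (b : Query (d + e) → ℕ → ℕ → ℕ) (m N : ℕ)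
    (t : Fin d → ℕ) : List ℕ :=
  Ps.flatMap fun P => (tuples N e).map fun s => b P m N + tupleIndex N (Fin.append t fun i => s i)

section ExtensionArgs

variable {maj : Bool} {g : ℕ → ℕ → List Gate} {d e : ℕ} {Ps : List (Query (d + e))}
  {b : Query (d + e) → ℕ → ℕ → ℕ}

theorem length_extensionArgs (m N : ℕ) (t : Fin d → ℕ) :
    (extensionArgs Ps b m N t).length = Ps.length * N ^ e := by
  simp [extensionArgs, length_tuples, List.length_flatMap]

theorem generable_encode_extensionArgs (hb : ∀ P ∈ Ps, ComputesAt g P (b P)) :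
    Generable fun v : Fin d ⊕ Bool → ℕ =>
      (extensionArgs Ps b (v (.inr true)) (v (.inr false)) (v ∘ .inl)).flatMap encodeNode := by
  let φ : Fin (d + e) → (Fin d ⊕ Bool) ⊕ Fin e := Fin.append (.inl ∘ .inl) .inr
  have hnode (P) (hP : P ∈ Ps) : Generable fun v : (Fin d ⊕ Bool) ⊕ Fin e → ℕ =>
      encodeNode (b P (v (.inl (.inr true))) (v (.inl (.inr false))) +
        tupleIndex (v (.inl (.inr false))) (v ∘ φ)) :=
    TickGenerable.encodeNode (.add ((hb P hP).ticks.comap fun c => Sum.inl (Sum.inr c))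
      (TickGenerable.tupleIndex (Sum.inl (Sum.inr false)) φ))
  refine (Generable.flatMap_list fun P hP => (hnode P hP).flatMap_tuples (.inr false)).congr
    fun v => ?_
  rw [extensionArgs, List.flatMap_assoc]
  congr 1
  funext P
  rw [List.flatMap_map]
  congr 1
  funext s
  congr 3
  funext i
  exact (apply_append (Sum.elim v fun k => (s k : ℕ)) (.inl ∘ .inl) .inr i).symm

theorem IsLayer.extension {κ : GateKind} (hb : ∀ P ∈ Ps, ComputesAt g P (b P))
    (hnot : κ = .not → Ps.length = 1 ∧ e = 0) (hmaj : maj = false → κ ≠ .maj) :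
    IsLayer maj g fun m N t => ⟨κ, extensionArgs Ps b m N t⟩ where
  args_lt m N hN t a ha := by
    simp only [extensionArgs, List.mem_flatMap, List.mem_map] at ha
    obtain ⟨P, hP, s, -, rfl⟩ := ha
    have := (hb P hP).lt m N hN (Fin.append t s)
    simp only [apply_append Fin.val] at this
    exact this
  not_unary m N t h := by
    obtain ⟨hlength, rfl⟩ := hnot h
    simp [length_extensionArgs, hlength]
  noMaj h _ _ _ := hmaj h
  size := by
    refine ⟨Ps.length + e, fun m N hN t => ?_⟩
    rw [length_extensionArgs, pow_add]
    gcongr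
    · exact Nat.lt_two_pow_self.le.trans (Nat.pow_le_pow_left (by omega) _)
    · nlinarith
  encode := ((generable_encode_extensionArgs hb).cons (.gate κ)).congr fun _ => rfl

open Classical in
theorem map_extensionArgs (hb : ∀ P ∈ Ps, ComputesAt g P (b P)) {m N : ℕ} (hN : N * N ≤ m)
    {x : List Bool} (hx : x.length = m) (t : Fin d → Fin N) :
    ((extensionArgs Ps b m N fun i => t i).map fun a => (values (g m N) x).getD a false) =
      Ps.flatMap fun P => (tuples N e).map fun s => decide (P N (rel N x) (Fin.append t s)) := by
  rw [extensionArgs, List.map_flatMap]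
  refine List.flatMap_congr fun P hP => ?_
  rw [List.map_map]
  refine List.map_congr_left fun s _ => ?_
  rw [Bool.eq_iff_iff, decide_eq_true_iff, ← (hb P hP).value m N hN x hx]
  simp only [apply_append Fin.val]
  rfl

end ExtensionArgs

open Classical in
/-- The number of pairs that satisfy `p`. -/
noncomputable def pairCount {N : ℕ} (p : Fin N → Fin N → Prop) : ℕ :=
  (Finset.univ.filter fun z : Fin N × Fin N => p z.1 z.2).card

open Classical in
theorem countP_map_tuples_two {N : ℕ} (p : Fin N → Fin N → Prop) :
    ((tuples N 2).map fun s => decide (p (s 0) (s 1))).countP id = pairCount p := by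
  rw [List.countP_map, countP_tuples, pairCount]
  exact Finset.card_equiv (finTwoArrowEquiv _) (by simp)

theorem pairCount_add_pairCount_not {N : ℕ} (p : Fin N → Fin N → Prop) :
    pairCount p + pairCount (fun x y => ¬p x y) = N ^ 2 := by
  rw [pairCount, pairCount, Finset.card_filter_add_card_filter_not]
  simp [sq]

theorem le_card_filter_iff {α : Type*} [Fintype α] {p : α → Prop} [DecidablePred p] {s : ℕ} :
    s ≤ (Finset.univ.filter p).card ↔ ∃ f : Fin s → α, Function.Injective f ∧ ∀ i, p (f i) := by
  constructor
  · intro hs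
    obtain ⟨f⟩ := Function.Embedding.nonempty_of_card_le (α := Fin s) (β := {x // p x})
      (by rwa [Fintype.card_fin, Fintype.card_subtype])
    exact ⟨fun i => f i, Subtype.val_injective.comp f.injective, fun i => (f i).2⟩
  · rintro ⟨f, hinj, hf⟩
    simpa using Finset.card_le_card_of_injOn (s := Finset.univ) f (by simpa using hf)
      hinj.injOn

namespace Definable

variable {maj : Bool} {d e : ℕ} {P Q : Query d}

theorem exists_stage {Ps : List (Query d)} (h : ∀ P ∈ Ps, Definable maj P)
    {g : ℕ → ℕ → List Gate} (hg : IsStage maj g) :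
    ∃ g', IsStage maj g' ∧ (∀ m N, g m N <+: g' m N) ∧ ∀ P ∈ Ps, ∃ b, ComputesAt g' P b := by
  induction Ps with
  | nil => exact ⟨g, hg, fun _ _ => List.prefix_rfl, by simp⟩
  | cons P Ps ih =>
    obtain ⟨g₁, hg₁, hpre₁, hPs⟩ := ih fun Q hQ => h Q (List.mem_cons_of_mem _ hQ)
    obtain ⟨g₂, b, hg₂, hpre₂, hP⟩ := h P List.mem_cons_self g₁ hg₁
    refine ⟨g₂, hg₂, fun m N => (hpre₁ m N).trans (hpre₂ m N), ?_⟩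
    rintro Q (_ | ⟨_, hQ⟩)
    · exact ⟨b, hP⟩
    · exact (hPs Q hQ).imp fun _ hb => hb.mono hpre₂

open Classical in
theorem gate (κ : GateKind)
    {Ps : List (∀ N, (Fin N → Fin N → Prop) → (Fin d → Fin N) → (Fin e → Fin N) → Prop)}
    (hPs : ∀ P ∈ Ps, Definable maj (d := d + e) fun N A u =>
      P N A (u ∘ Fin.castAdd e) (u ∘ Fin.natAdd d))
    (hnot : κ = .not → Ps.length = 1 ∧ e = 0) (hmaj : maj = false → κ ≠ .maj) :
    Definable maj fun N A t =>
      κ.eval (Ps.flatMap fun P => (tuples N e).map fun s => decide (P N A t s)) = true := by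
  intro g hg
  obtain ⟨g₁, hg₁, hpre₁, hb⟩ := exists_stage (List.forall_mem_map.2 hPs) hg
  choose! b hb using hb
  have hlayer := IsLayer.extension hb (by simpa using hnot) hmaj
  refine (hlayer.exists_computesAt hg₁ fun m N hN x hx t => ?_).imp fun g₂ ⟨c, hg₂, hpre₂, hc⟩ =>
    ⟨c, hg₂, fun m N => (hpre₁ m N).trans (hpre₂ m N), hc⟩
  have hleft (s : Fin e → Fin N) : Fin.append t s ∘ Fin.castAdd e = t :=
    funext (Fin.append_left t s)
  have hright (s : Fin e → Fin N) : Fin.append t s ∘ Fin.natAdd d = s :=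
    funext (Fin.append_right t s)
  rw [Gate.value_eq_eval (hlayer.not_unary m N _), map_extensionArgs hb hN hx, List.flatMap_map]
  simp only [hleft, hright]

theorem congr (hP : Definable maj P) (h : ∀ N A t, Q N A t ↔ P N A t) : Definable maj Q := by
  rwa [funext fun N => funext fun A => funext fun t => propext (h N A t)]

theorem adj (i j : Fin d) : Definable maj fun _ A t => A (t i) (t j) := fun g hg =>
  (IsLayer.adj i j).exists_computesAt hg fun m N hN x hx t => by
    have hlt := (IsLayer.adj (maj := maj) (g := fun _ _ => []) i j).args_lt m N hN t
    simp only [List.mem_singleton, forall_eq, List.length_nil, add_zero, ← hx] at hlt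
    simp only [Gate.value, List.any_cons, List.any_nil, Bool.or_false, rel,
      getD_eq_of_isPrefix (isPrefix_values (g m N) x) hlt]

theorem lt (i j : Fin d) : Definable maj fun _ _ t => t i < t j := fun g hg =>
  (IsLayer.lt i j).exists_computesAt hg fun _ _ _ _ _ t => by
    split_ifs with h <;> simpa [Gate.value] using h

theorem not (hP : Definable maj P) : Definable maj fun N A t => ¬ P N A t :=
  (gate (e := 0) .not (Ps := [fun N A t _ => P N A t]) (by simpa using hP) (by simp)
    (by simp)).congr fun N A t => by simp [GateKind.eval, tuples_zero]

theorem and (hP : Definable maj P) (hQ : Definable maj Q) :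
    Definable maj fun N A t => P N A t ∧ Q N A t :=
  (gate (e := 0) .and (Ps := [fun N A t _ => P N A t, fun N A t _ => Q N A t])
    (by simpa using ⟨hP, hQ⟩) (by simp) (by simp)).congr fun N A t => by
    simp [GateKind.eval, tuples_zero]

theorem or (hP : Definable maj P) (hQ : Definable maj Q) :
    Definable maj fun N A t => P N A t ∨ Q N A t :=
  (hP.not.and hQ.not).not.congr fun _ _ _ => by tauto

theorem imp (hP : Definable maj P) (hQ : Definable maj Q) :
    Definable maj fun N A t => P N A t → Q N A t :=
  (hP.not.or hQ).congr fun _ _ _ => by tauto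

theorem eq (i j : Fin d) : Definable maj fun _ _ t => t i = t j :=
  ((lt i j).or (lt j i)).not.congr fun _ _ _ => by omega

theorem forall_mem {ι : Type*} {P : ι → Query d} {l : List ι}
    (h : ∀ i ∈ l, Definable maj (P i)) : Definable maj fun N A t => ∀ i ∈ l, P i N A t :=
  (gate (e := 0) .and (Ps := l.map fun i N A t _ => P i N A t) (List.forall_mem_map.2 h) (by simp)
    (by simp)).congr fun N A t => by
    simp [GateKind.eval, tuples_zero, List.flatMap_map]

theorem exists_mem {ι : Type*} {P : ι → Query d} {l : List ι}
    (h : ∀ i ∈ l, Definable maj (P i)) : Definable maj fun N A t => ∃ i ∈ l, P i N A t :=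
  (forall_mem fun i hi => (h i hi).not).not.congr fun _ _ _ => by simp

theorem exists_tuple
    {P : ∀ N, (Fin N → Fin N → Prop) → (Fin d → Fin N) → (Fin e → Fin N) → Prop}
    (hP : Definable maj (d := d + e) fun N A t =>
      P N A (t ∘ Fin.castAdd e) (t ∘ Fin.natAdd d)) :
    Definable maj fun N A t => ∃ s, P N A t s :=
  (gate (e := e) .or (Ps := [P]) (List.forall_mem_singleton.2 hP) (by simp) (by simp)).congr
    fun N A t => by simp [GateKind.eval, mem_tuples]

theorem exists_vertex {P : ∀ N, (Fin N → Fin N → Prop) → (Fin d → Fin N) → Fin N → Prop}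
    (hP : Definable maj (d := d + 1) fun N A t => P N A (t ∘ Fin.castSucc) (t (Fin.last d))) :
    Definable maj fun N A t => ∃ x, P N A t x :=
  (exists_tuple (e := 1) (P := fun N A t s => P N A t (s 0)) hP).congr fun _ _ _ =>
    ⟨fun ⟨x, hx⟩ => ⟨fun _ => x, hx⟩, fun ⟨s, hs⟩ => ⟨s 0, hs⟩⟩

theorem forall_vertex {P : ∀ N, (Fin N → Fin N → Prop) → (Fin d → Fin N) → Fin N → Prop}
    (hP : Definable maj (d := d + 1) fun N A t => P N A (t ∘ Fin.castSucc) (t (Fin.last d))) :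
    Definable maj fun N A t => ∀ x, P N A t x :=
  (exists_vertex (P := fun N A t x => ¬P N A t x) hP.not).not.congr fun _ _ _ =>
    not_exists_not.symm

open Classical in
theorem le_card_filter {p : ∀ N, (Fin N → Fin N → Prop) → (Fin d → Fin N) → Fin N → Prop} (s : ℕ)
    (hp : ∀ i : Fin s, Definable maj (d := d + s) fun N A t =>
      p N A (t ∘ Fin.castAdd s) (t (Fin.natAdd d i))) :
    Definable maj fun N A t => s ≤ (Finset.univ.filter (p N A t)).card := by
  let l : List (Fin s × Fin s) := (Finset.univ.filter fun c => c.1 ≠ c.2).toList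
  refine (exists_tuple (P := fun N A t f =>
    (∀ c ∈ l, f c.1 ≠ f c.2) ∧ ∀ i ∈ List.finRange s, p N A t (f i))
    ((forall_mem fun c _ => (eq _ _).not).and (forall_mem fun i _ => hp i))).congr
    fun N A t => ?_
  rw [le_card_filter_iff]
  refine exists_congr fun f => and_congr ?_ (by simp)
  simp [l, Function.Injective, not_imp_not]

theorem card_vertices_le (s : ℕ) : Definable maj (d := d) fun N _ _ => N ≤ s :=
  (le_card_filter (p := fun _ _ _ _ => True) (s + 1) fun _ =>
    (forall_mem (l := ([] : List (Query _))) (P := id) (by simp)).congr (by simp)).not.congr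
    fun N _ _ => by simp

theorem pairCount_le
    {P Q : ∀ N, (Fin N → Fin N → Prop) → (Fin d → Fin N) → Fin N → Fin N → Prop}
    (hP : Definable true (d := d + 2) fun N A t =>
      P N A (t ∘ Fin.castAdd 2) (t (Fin.natAdd d 0)) (t (Fin.natAdd d 1)))
    (hQ : Definable true (d := d + 2) fun N A t =>
      Q N A (t ∘ Fin.castAdd 2) (t (Fin.natAdd d 0)) (t (Fin.natAdd d 1))) :
    Definable true fun N A t => pairCount (P N A t) ≤ pairCount (Q N A t) :=
  -- If `P` holds for `p` and `Q` for `q` of the `N²` pairs, then `N² - p + q` of the `2 N²` inputs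
  -- of the gate are true.
  (gate (e := 2) .maj
    (Ps := [fun N A t s => ¬P N A t (s 0) (s 1), fun N A t s => Q N A t (s 0) (s 1)])
    (by simpa using ⟨hP.not, hQ⟩) (by simp) (by simp)).congr fun N A t => by
    simp only [GateKind.eval, List.flatMap_cons, List.flatMap_nil, List.append_nil,
      List.length_append, List.length_map, length_tuples, List.countP_append,
      countP_map_tuples_two (Q N A t), countP_map_tuples_two fun x y => ¬P N A t x y,
      decide_eq_true_iff]
    have := pairCount_add_pairCount_not (P N A t)
    omega

theorem pairCount_eq
    {P Q : ∀ N, (Fin N → Fin N → Prop) → (Fin d → Fin N) → Fin N → Fin N → Prop}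
    (hP : Definable true (d := d + 2) fun N A t =>
      P N A (t ∘ Fin.castAdd 2) (t (Fin.natAdd d 0)) (t (Fin.natAdd d 1)))
    (hQ : Definable true (d := d + 2) fun N A t =>
      Q N A (t ∘ Fin.castAdd 2) (t (Fin.natAdd d 0)) (t (Fin.natAdd d 1))) :
    Definable true fun N A t => pairCount (P N A t) = pairCount (Q N A t) :=
  ((pairCount_le hP hQ).and (pairCount_le hQ hP)).congr fun _ _ _ => le_antisymm_iff

end Definable

/-! ### Circuit families -/

theorem tuples_three (N : ℕ) :
    tuples N 3 = List.ofFn fun i : Fin (N * (N * N)) =>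
      ![i.modNat.modNat, i.modNat.divNat, i.divNat] := by
  rw [tuples, List.ofFn_congr (show N ^ 3 = N * (N * N) by ring)]
  congr 1
  funext i
  rw [Equiv.symm_apply_eq, Fin.ext_iff, finFunctionFinEquiv_apply_val, Fin.sum_univ_three]
  have hi := Nat.div_add_mod (i : ℕ) (N * N)
  have hj := Nat.div_add_mod (i % (N * N) : ℕ) N
  simp only [Fin.val_cast, Matrix.cons_val, Fin.coe_modNat, Fin.coe_divNat, Fin.val_zero,
    Fin.val_one, Fin.val_two]
  linarith

theorem exists_add_two_pow_le (c : ℕ) : ∃ e, ∀ m : ℕ, (m + 2) ^ c ≤ m ^ e + e := by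
  refine ⟨2 * c + 3 ^ c, fun m => ?_⟩
  rcases Nat.lt_or_ge m 2 with hm | hm
  · have : (m + 2) ^ c ≤ 3 ^ c := Nat.pow_le_pow_left (by omega) c
    omega
  · calc (m + 2) ^ c ≤ (m ^ 2) ^ c := Nat.pow_le_pow_left (by nlinarith) c
      _ = m ^ (2 * c) := (pow_mul _ _ _).symm
      _ ≤ m ^ (2 * c + 3 ^ c) := Nat.pow_le_pow_right (by omega) (Nat.le_add_right _ _)
      _ ≤ _ := Nat.le_add_right _ _

/-- The circuits of the stage `g` for `N = √m`, whose outputs are the nodes from `b m N` on that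
belong to the tuples of length `d`. -/
def stageFamily (g : ℕ → ℕ → List Gate) (b : ℕ → ℕ → ℕ) (d : ℕ) : CircuitFamily := fun m =>
  ⟨g m m.sqrt, (tuples m.sqrt d).map fun t => b m m.sqrt + tupleIndex m.sqrt fun i => t i⟩

section StageFamily

variable {maj : Bool} {g : ℕ → ℕ → List Gate} {d : ℕ} {P : Query d} {b : ℕ → ℕ → ℕ}

theorem ComputesAt.logspaceUniform (hg : IsStage maj g) (hb : ComputesAt g P b) :
    (stageFamily g b d).LogspaceUniform := by
  have haddress : Generable fun v : Bool ⊕ Fin d → ℕ =>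
      encodeNode (b (v (.inl true)) (v (.inl false)) +
        tupleIndex (v (.inl false)) (v ∘ Sum.inr)) :=
    TickGenerable.encodeNode (.add (hb.ticks.comap Sum.inl)
      (TickGenerable.tupleIndex (Sum.inl false) Sum.inr))
  have houtputs := (haddress.flatMap_tuples false).cons CircuitSymbol.out
  refine Generable.logspace (f := fun v => Circuit.encode (v true)
    ⟨g (v true) (v false), (tuples (v false) d).map fun t =>
      b (v true) (v false) + tupleIndex (v false) fun i => t i⟩) ?_
  refine (((TickGenerable.var true).encodeNode.append hg.encode).append houtputs).congr fun v => ?_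
  rw [Circuit.encode, List.flatMap_map]
  rfl

theorem ComputesAt.isTC0 (hg : IsStage maj g) (hb : ComputesAt g P b) :
    (stageFamily g b d).IsTC0 where
  wellFormed m :=
    { args_lt := hg.args_lt m _ m.sqrt_le
      not_unary := hg.not_unary m _
      outputs_lt := List.forall_mem_map.2 fun t _ => hb.lt m _ m.sqrt_le t }
  polySize := by
    obtain ⟨c, hc⟩ := hg.size
    exact (exists_add_two_pow_le c).imp fun e he m => (hc m _ m.sqrt_le).trans (he m)
  constDepth := by
    obtain ⟨D, hD⟩ := hg.depth
    exact ⟨D, fun m => foldr_max_le (hD m _ m.sqrt_le)⟩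
  uniform := hb.logspaceUniform hg

open Classical in
theorem ComputesAt.output_stageFamily (hb : ComputesAt g P b) {N : ℕ} {x : List Bool}
    (hx : x.length = N * N) :
    (stageFamily g b d (N * N)).output x =
      (tuples N d).map fun t => decide (P N (rel N x) t) := by
  rw [stageFamily, Nat.sqrt_eq, Circuit.output, List.map_map]
  refine List.map_congr_left fun t _ => ?_
  rw [Bool.eq_iff_iff, decide_eq_true_iff, ← hb.value (N * N) N le_rfl x hx t]
  rfl

end StageFamily

theorem rel_graphBits {N : ℕ} (G : SimpleGraph (Fin N)) : rel N (graphBits G) = G.Adj := by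
  classical
  funext u v
  have hcode : (u * N + v : ℕ) = finProdFinEquiv (u, v) := by
    rw [finProdFinEquiv_apply_val]
    ring
  have hpair : ((finProdFinEquiv (u, v)).divNat, (finProdFinEquiv (u, v)).modNat) = (u, v) :=
    finProdFinEquiv.symm_apply_apply (u, v)
  obtain ⟨hdiv, hmod⟩ := Prod.mk.inj hpair
  rw [rel, hcode, List.getD_eq_getElem?_getD, graphBits, matrixBits, List.getElem?_ofFn,
    dif_pos (finProdFinEquiv (u, v)).isLt]
  simp only [Fin.eta, hdiv, hmod, Option.getD_some, decide_eq_true_iff]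

/-- A property of triples of vertices of a graph with the vertices `Fin N`. -/
abbrev TernaryQuery := ∀ N, (Fin N → Fin N → Prop) → Fin N → Fin N → Fin N → Prop

/-- The ternary query `E` is definable for any three entries of a tuple. -/
def TernaryDefinable (maj : Bool) (E : TernaryQuery) : Prop :=
  ∀ d (u v w : Fin d), Definable maj fun N A (t : Fin d → Fin N) => E N A (t u) (t v) (t w)

open Classical in
/-- The matrix whose column `(u, v)` consists of the vertices `p` with `E u v p`. -/
noncomputable def entryMatrix (E : TernaryQuery) {N : ℕ} (G : SimpleGraph (Fin N)) (p : Fin N)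
    (j : Fin (N * N)) : Bool :=
  decide (E N G.Adj j.divNat j.modNat p)

theorem mem_column_entryMatrix {E : TernaryQuery} {N : ℕ} {G : SimpleGraph (Fin N)} {p : Fin N}
    {j : Fin (N * N)} :
    p ∈ column (entryMatrix E G) j ↔ E N G.Adj j.divNat j.modNat p := by
  classical
  rw [column, Finset.mem_filter_univ, entryMatrix, decide_eq_true_iff]

theorem TernaryDefinable.exists_family {maj : Bool} {E : TernaryQuery}
    (hE : TernaryDefinable maj E) :
    ∃ C : CircuitFamily, C.IsTC0 ∧ (maj = false → C.IsAC0) ∧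
      ∀ (N : ℕ) (G : SimpleGraph (Fin N)),
        (C (N * N)).output (graphBits G) = matrixBits (entryMatrix E G) := by
  obtain ⟨g, b, hg, -, hb⟩ := hE 3 1 0 2 _ (isStage_nil maj)
  refine ⟨stageFamily g b 3, hb.isTC0 hg,
    fun hmaj => ⟨hb.isTC0 hg, fun m => hg.noMaj hmaj m _⟩, fun N G => ?_⟩
  rw [hb.output_stageFamily (by simp [graphBits, matrixBits]), rel_graphBits, tuples_three,
    List.map_ofFn]
  rfl

/-! ### Nets -/

section EdgeNhd

variable {P : Type} {lines : Finset (Finset P)} {l : Finset P} {u v z : P}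

theorem isClique_netGraph (hl : l ∈ lines) : (netGraph lines).IsClique (l : Set P) :=
  fun _ hx _ hy hxy => ⟨hxy, l, hl, hx, hy⟩

theorem mem_edgeNhd [Fintype P] {G : SimpleGraph P} :
    z ∈ edgeNhd G u v ↔ z = u ∨ z = v ∨ (G.Adj u z ∧ G.Adj v z) := by
  simp [edgeNhd]

theorem subset_edgeNhd_netGraph [Fintype P] (hl : l ∈ lines) (hu : u ∈ l) (hv : v ∈ l) :
    l ⊆ edgeNhd (netGraph lines) u v := by
  intro z hz
  by_cases hzu : z = u
  · exact mem_edgeNhd.2 (.inl hzu)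
  by_cases hzv : z = v
  · exact mem_edgeNhd.2 (.inr (.inl hzv))
  exact mem_edgeNhd.2 (.inr (.inr
    ⟨isClique_netGraph hl hu hz (Ne.symm hzu), isClique_netGraph hl hv hz (Ne.symm hzv)⟩))

end EdgeNhd

namespace IsNet

variable {P : Type} [Fintype P] [DecidableEq P] {n k : ℕ} {lines : Finset (Finset P)}
  {l l' : Finset P} {u v w : P}

theorem eq_of_mem (h : IsNet n k lines) (hl : l ∈ lines) (hl' : l' ∈ lines) (huv : u ≠ v)
    (hu : u ∈ l) (hv : v ∈ l) (hu' : u ∈ l') (hv' : v ∈ l') : l = l' := by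
  by_contra hne
  obtain ⟨cls, hcls⟩ := h.parallel
  obtain ⟨hdisj, hcard⟩ := hcls l hl l' hl' hne
  by_cases hc : cls l = cls l'
  · exact Finset.disjoint_left.1 (hdisj hc) hu hu'
  · exact huv (Finset.card_le_one.1 (hcard hc).le u (Finset.mem_inter.2 ⟨hu, hu'⟩) v
      (Finset.mem_inter.2 ⟨hv, hv'⟩))

theorem existsUnique_line (h : IsNet n k lines) (huv : (netGraph lines).Adj u v) :
    ∃! l : Finset P, l ∈ lines ∧ u ∈ l ∧ v ∈ l := by
  obtain ⟨hne, l, hl, hu, hv⟩ := huv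
  exact ⟨l, ⟨hl, hu, hv⟩, fun l' ⟨hl', hu', hv'⟩ => h.eq_of_mem hl' hl hne hu' hv' hu hv⟩

theorem le_degreeIn (h : IsNet n k lines) (hl : l ∈ lines) (hu : u ∈ l) (hv : v ∈ l)
    (hw : w ∈ l) :
    n - 1 ≤ degreeIn (netGraph lines) (edgeNhd (netGraph lines) u v) w := by
  classical
  rw [← h.card_line l hl, ← Finset.card_erase_of_mem hw, degreeIn]
  refine Finset.card_le_card fun z hz => ?_
  obtain ⟨hzw, hz⟩ := Finset.mem_erase.1 hz
  exact Finset.mem_filter.2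
    ⟨subset_edgeNhd_netGraph hl hu hv hz, isClique_netGraph hl hw hz hzw.symm⟩

theorem exists_injOn_class (h : IsNet n k lines) :
    ∃ cls : Finset P → Fin k, ∀ z, Set.InjOn cls {l | l ∈ lines ∧ z ∈ l} := by
  refine h.parallel.imp fun cls hcls z l ⟨hl, hz⟩ l' ⟨hl', hz'⟩ hc => ?_
  by_contra hne
  exact Finset.disjoint_left.1 ((hcls l hl l' hl' hne).1 hc) hz hz'

open Classical in
theorem card_filter_adj_le (h : IsNet n k lines) (hl : l ∈ lines) (hw : w ∉ l) :
    (l.filter fun z => (netGraph lines).Adj w z).card ≤ k - 1 := by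
  obtain ⟨cls, hcls⟩ := h.exists_injOn_class
  rw [← Finset.card_fin k, ← Finset.card_erase_of_mem (Finset.mem_univ (cls l))]
  refine Finset.card_le_card_of_forall_subsingleton
    (fun z i => ∃ m ∈ lines, w ∈ m ∧ z ∈ m ∧ cls m = i) (fun z hz => ?_) ?_
  · obtain ⟨hzl, -, m, hm, hwm, hzm⟩ := Finset.mem_filter.1 hz
    refine ⟨cls m, Finset.mem_erase.2 ⟨fun he => hw ?_, Finset.mem_univ _⟩, m, hm, hwm, hzm, rfl⟩
    exact hcls z ⟨hm, hzm⟩ ⟨hl, hzl⟩ he ▸ hwm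
  · rintro i - z ⟨hz, m, hm, hwm, hzm, rfl⟩ z' ⟨hz', m', hm', hwm', hzm', he⟩
    obtain rfl := hcls w ⟨hm', hwm'⟩ ⟨hm, hwm⟩ he
    by_contra hne
    exact hw (h.eq_of_mem hm' hl hne hzm hzm' (Finset.mem_filter.1 hz).1
      (Finset.mem_filter.1 hz').1 ▸ hwm)

theorem card_edgeNhd_sdiff_le (h : IsNet n k lines) (huv : u ≠ v) (hl : l ∈ lines) (hu : u ∈ l)
    (hv : v ∈ l) :
    (edgeNhd (netGraph lines) u v \ l).card ≤ (k - 1) * (k - 1) - (k - 1) := by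
  obtain ⟨cls, hcls⟩ := h.exists_injOn_class
  have hmeet {m m' : Finset P} {z : P} (hz : z ∉ l) (hm : m ∈ lines) (hm' : m' ∈ lines)
      (hum : u ∈ m) (hvm' : v ∈ m') (hzm : z ∈ m) : m ≠ m' := by
    rintro rfl
    exact hz (h.eq_of_mem hm hl huv hum hvm' hu hv ▸ hzm)
  have hclass {m : Finset P} {x z : P} (hz : z ∉ l) (hx : x ∈ l) (hm : m ∈ lines) (hxm : x ∈ m)
      (hzm : z ∈ m) : cls m ∈ Finset.univ.erase (cls l) :=
    Finset.mem_erase.2 ⟨fun he => hz (hcls x ⟨hm, hxm⟩ ⟨hl, hx⟩ he ▸ hzm), Finset.mem_univ _⟩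
  rw [← Finset.card_fin k, ← Finset.card_erase_of_mem (Finset.mem_univ (cls l)),
    ← Finset.offDiag_card]
  refine Finset.card_le_card_of_forall_subsingleton
    (fun z c => (∃ m ∈ lines, u ∈ m ∧ z ∈ m ∧ cls m = c.1) ∧
      ∃ m ∈ lines, v ∈ m ∧ z ∈ m ∧ cls m = c.2) (fun z hz => ?_) ?_
  · obtain ⟨hzH, hzl⟩ := Finset.mem_sdiff.1 hz
    rcases mem_edgeNhd.1 hzH with rfl | rfl | ⟨⟨-, m, hm, hum, hzm⟩, -, m', hm', hvm', hzm'⟩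
    · exact absurd hu hzl
    · exact absurd hv hzl
    · refine ⟨(cls m, cls m'), Finset.mem_offDiag.2 ⟨hclass hzl hu hm hum hzm,
        hclass hzl hv hm' hvm' hzm', fun he => ?_⟩, ⟨m, hm, hum, hzm, rfl⟩,
        m', hm', hvm', hzm', rfl⟩
      exact hmeet hzl hm hm' hum hvm' hzm (hcls z ⟨hm, hzm⟩ ⟨hm', hzm'⟩ he)
  · rintro ⟨i, j⟩ - z ⟨hz, ⟨m, hm, hum, hzm, rfl⟩, m', hm', hvm', hzm', rfl⟩
      z' ⟨-, ⟨m₁, hm₁, hum₁, hzm₁, he⟩, m₁', hm₁', hvm₁', hzm₁', he'⟩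
    obtain rfl := hcls u ⟨hm₁, hum₁⟩ ⟨hm, hum⟩ he
    obtain rfl := hcls v ⟨hm₁', hvm₁'⟩ ⟨hm', hvm'⟩ he'
    by_contra hne
    exact hmeet (Finset.mem_sdiff.1 hz).2 hm hm' hum hvm' hzm
      (h.eq_of_mem hm hm' hne hzm hzm₁ hzm' hzm₁')

theorem degreeIn_lt (h : IsNet n k lines) (huv : u ≠ v) (hl : l ∈ lines) (hu : u ∈ l)
    (hv : v ∈ l) (hw : w ∈ edgeNhd (netGraph lines) u v) (hwl : w ∉ l) :
    degreeIn (netGraph lines) (edgeNhd (netGraph lines) u v) w < (k - 1) ^ 2 := by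
  classical
  set H := edgeNhd (netGraph lines) u v
  have hwH : w ∈ H \ l := Finset.mem_sdiff.2 ⟨hw, hwl⟩
  have hsub : (H.filter fun z => (netGraph lines).Adj w z) ⊆
      (l.filter fun z => (netGraph lines).Adj w z) ∪ (H \ l).erase w := by
    intro z hz
    obtain ⟨hzH, hwz⟩ := Finset.mem_filter.1 hz
    by_cases hzl : z ∈ l
    · exact Finset.mem_union_left _ (Finset.mem_filter.2 ⟨hzl, hwz⟩)
    · exact Finset.mem_union_right _ (Finset.mem_erase.2
        ⟨hwz.ne', Finset.mem_sdiff.2 ⟨hzH, hzl⟩⟩)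
  have hdegree := (Finset.card_le_card hsub).trans (Finset.card_union_le _ _)
  rw [Finset.card_erase_of_mem hwH] at hdegree
  have hon := h.card_filter_adj_le hl hwl
  have hoff : (H \ l).card ≤ (k - 1) * (k - 1) - (k - 1) := h.card_edgeNhd_sdiff_le huv hl hu hv
  have hpos : 0 < (H \ l).card := Finset.card_pos.2 ⟨w, hwH⟩
  rw [degreeIn, sq]
  omega

theorem mem_line_iff (h : IsNet n k lines) (hk : (k - 1) ^ 2 < n) (huv : u ≠ v) (hl : l ∈ lines)
    (hu : u ∈ l) (hv : v ∈ l) :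
    w ∈ l ↔ w ∈ edgeNhd (netGraph lines) u v ∧
      n - 1 ≤ degreeIn (netGraph lines) (edgeNhd (netGraph lines) u v) w := by
  refine ⟨fun hw => ⟨subset_edgeNhd_netGraph hl hu hv hw, h.le_degreeIn hl hu hv hw⟩,
    fun ⟨hw, hd⟩ => ?_⟩
  by_contra hwl
  exact (hd.trans_lt (h.degreeIn_lt huv hl hu hv hw hwl)).not_ge (Nat.le_sub_one_of_lt hk)

end IsNet

/-! ### The first two points of a line -/

/-- The pair consists of the first two points of the set `l`. -/
def IsFirstPair {α : Type*} [LinearOrder α] (l : Finset α) (z : α × α) : Prop :=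
  z.1 ∈ l ∧ z.2 ∈ l ∧ z.1 < z.2 ∧ ∀ w ∈ l, w < z.2 → w = z.1

section FirstPair

variable {α : Type*} [LinearOrder α] {l : Finset α}

theorem exists_isFirstPair (hl : 2 ≤ l.card) : ∃ z, IsFirstPair l z := by
  have hne : l.Nonempty := Finset.card_pos.1 (by omega)
  have hne' : (l.erase (l.min' hne)).Nonempty := by
    rw [← Finset.card_pos, Finset.card_erase_of_mem (l.min'_mem hne)]
    omega
  obtain ⟨hsecond, hmem⟩ := Finset.mem_erase.1 ((l.erase (l.min' hne)).min'_mem hne')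
  refine ⟨(l.min' hne, (l.erase (l.min' hne)).min' hne'), l.min'_mem hne, hmem,
    lt_of_le_of_ne (l.min'_le _ hmem) hsecond.symm, fun w hw hlt => ?_⟩
  by_contra hwne
  exact absurd (Finset.min'_le _ _ (Finset.mem_erase.2 ⟨hwne, hw⟩)) (not_le.2 hlt)

theorem IsFirstPair.snd_le {z z' : α × α} (h : IsFirstPair l z) (h' : IsFirstPair l z') :
    z.2 ≤ z'.2 := by
  by_contra! hlt
  exact h'.2.2.1.ne ((h.2.2.2 _ h'.1 (h'.2.2.1.trans hlt)).trans (h.2.2.2 _ h'.2.1 hlt).symm)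

theorem IsFirstPair.unique {z z' : α × α} (h : IsFirstPair l z) (h' : IsFirstPair l z') :
    z = z' := by
  have hsnd : z.2 = z'.2 := (h.snd_le h').antisymm (h'.snd_le h)
  exact Prod.ext (h'.2.2.2 _ h.1 (hsnd ▸ h.2.2.1)) hsnd

end FirstPair

/-! ### Recognizing lines -/

section LineQueries

variable {α : Type*}

/-- `z` belongs to the neighbourhood of the edge `u v`. -/
def InNhd (A : α → α → Prop) (u v z : α) : Prop := z = u ∨ z = v ∨ (A u z ∧ A v z)

/-- `z` is a neighbour of `w` in the neighbourhood of the edge `u v`. -/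
def NhdAdj (A : α → α → Prop) (u v w z : α) : Prop := InNhd A u v z ∧ A w z

/-- `w` belongs to the neighbourhood of the edge `u v` and its degree `e` there satisfies
`N ≤ (e + 1) ^ 2`, the latter being expressed through numbers of pairs. -/
def MajLine : TernaryQuery := fun N A u v w =>
  InNhd A u v w ∧ pairCount (fun y z : Fin N => y = z) ≤
    pairCount fun y z => (y = w ∨ NhdAdj A u v w y) ∧ (z = w ∨ NhdAdj A u v w z)

open Classical in
/-- `w` belongs to the neighbourhood of the edge `u v` and its degree there is at least `c` or at
least some `s < c` with `N ≤ (s + 1) ^ 2`. -/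
def BoundedLine (c : ℕ) : TernaryQuery := fun N A u v w =>
  InNhd A u v w ∧ (c ≤ (Finset.univ.filter (NhdAdj A u v w)).card ∨
    ∃ s ∈ List.range c, N ≤ (s + 1) ^ 2 ∧ s ≤ (Finset.univ.filter (NhdAdj A u v w)).card)

/-- `u` and `v` are the first two vertices of the line through them. -/
def FirstPair (line : TernaryQuery) (N : ℕ) (A : Fin N → Fin N → Prop) (u v : Fin N) : Prop :=
  A u v ∧ u < v ∧ ∀ w, w < v → line N A u v w → w = u

/-- The pair `(a, b)` precedes `(u, v)` lexicographically. -/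
def LexLt [LT α] (a b u v : α) : Prop := a < u ∨ a = u ∧ b < v

/-- The line with the first pair `(u, v)` is written into the column `(u, v)`. -/
def SparseEntry (line : TernaryQuery) : TernaryQuery := fun N A u v p =>
  N ≤ 1 ∨ FirstPair line N A u v ∧ line N A u v p

/-- The lines are written into the first columns in the lexicographic order of their first pairs:
the number of the column `(c, c')` is the number of pairs that precede `(c, c')`. -/
def RankedEntry (line : TernaryQuery) : TernaryQuery := fun N A c c' p =>
  N ≤ 1 ∨ ∃ u v, (FirstPair line N A u v ∧ line N A u v p) ∧
    pairCount (fun a b => FirstPair line N A a b ∧ LexLt a b u v) =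
      pairCount fun a b => LexLt a b c c'

end LineQueries

section DefinableLine

variable {maj : Bool} {line : TernaryQuery} {d : ℕ}

theorem Definable.inNhd (u v z : Fin d) :
    Definable maj fun _ A t => InNhd A (t u) (t v) (t z) :=
  (eq z u).or ((eq z v).or ((adj u z).and (adj v z)))

theorem Definable.nhdAdj (u v w z : Fin d) :
    Definable maj fun _ A t => NhdAdj A (t u) (t v) (t w) (t z) :=
  (inNhd u v z).and (adj w z)

theorem Definable.lexLt (a b u v : Fin d) :
    Definable maj fun _ _ t => LexLt (t a) (t b) (t u) (t v) :=
  (lt a u).or ((eq a u).and (lt b v))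

theorem majLine : TernaryDefinable true MajLine := fun _ u v w =>
  (Definable.inNhd u v w).and (Definable.pairCount_le (Definable.eq _ _)
    (((Definable.eq _ _).or (Definable.nhdAdj _ _ _ _)).and
      ((Definable.eq _ _).or (Definable.nhdAdj _ _ _ _))))

theorem boundedLine (c : ℕ) : TernaryDefinable maj (BoundedLine c) := fun d u v w =>
  have hcard (s : ℕ) := Definable.le_card_filter (maj := maj)
    (p := fun _ A (t : Fin d → _) => NhdAdj A (t u) (t v) (t w)) s fun _ =>
      Definable.nhdAdj _ _ _ _
  (Definable.inNhd u v w).and ((hcard c).or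
    (Definable.exists_mem fun s _ => (Definable.card_vertices_le _).and (hcard s)))

namespace TernaryDefinable

theorem firstPair (hline : TernaryDefinable maj line) (u v : Fin d) :
    Definable maj fun N A t => FirstPair line N A (t u) (t v) :=
  (Definable.adj u v).and ((Definable.lt u v).and (Definable.forall_vertex
    ((Definable.lt _ _).imp ((hline _ _ _ _).imp (Definable.eq _ _)))))

theorem sparseEntry (hline : TernaryDefinable maj line) :
    TernaryDefinable maj (SparseEntry line) := fun d u v p =>
  (Definable.card_vertices_le 1).or ((hline.firstPair u v).and (hline d u v p))

theorem rankedEntry (hline : TernaryDefinable true line) :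
    TernaryDefinable true (RankedEntry line) := fun _ _ _ _ =>
  (Definable.card_vertices_le 1).or (Definable.exists_vertex (Definable.exists_vertex
    (((hline.firstPair _ _).and (hline _ _ _ _)).and (Definable.pairCount_eq
      ((hline.firstPair _ _).and (Definable.lexLt _ _ _ _)) (Definable.lexLt _ _ _ _)))))

end TernaryDefinable

end DefinableLine

/-! ### Counting pairs -/

section PairCount

variable {N : ℕ}

theorem pairCount_eq_self : pairCount (fun y z : Fin N => y = z) = N := by
  classical
  refine (Finset.card_bij (fun y _ => (y, y)) ?_ ?_ ?_).symm.trans (Finset.card_fin N) <;> simp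

theorem pairCount_and (p : Fin N → Prop) [DecidablePred p] :
    pairCount (fun y z => p y ∧ p z) = (Finset.univ.filter p).card ^ 2 := by
  rw [pairCount, sq, ← Finset.card_product]
  congr 1
  ext z
  simp

open Classical in
theorem pairCount_eq_card (p : Fin N → Fin N → Prop) :
    pairCount p =
      (Finset.univ.filter fun j : Fin (N * N) => p j.divNat j.modNat).card :=
  (Finset.card_equiv finProdFinEquiv.symm (by simp)).symm

theorem lexLt_divNat_modNat {i j : Fin (N * N)} :
    LexLt i.divNat i.modNat j.divNat j.modNat ↔ i < j := by
  rw [LexLt, Fin.lt_def, Fin.lt_def, Fin.ext_iff, Fin.lt_def, Fin.coe_divNat, Fin.coe_modNat,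
    Fin.coe_divNat, Fin.coe_modNat]
  rcases lt_trichotomy (i / N : ℕ) (j / N) with h | h | h
  · simp only [h, true_or, Nat.lt_of_div_lt_div h]
  · have hi := Nat.div_add_mod i N
    have hj := Nat.div_add_mod j N
    rw [h] at hi
    omega
  · have := Nat.lt_of_div_lt_div h
    omega

theorem pairCount_lexLt (j : Fin (N * N)) :
    pairCount (fun a b => LexLt a b j.divNat j.modNat) = j := by
  classical
  simp only [pairCount_eq_card, lexLt_divNat_modNat, Finset.filter_gt_eq_Iio, Fin.card_Iio]

end PairCount

section Rank

variable {ι α : Type*} [Fintype ι] [LinearOrder α] (key : ι ↪ α)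

/-- The number of indices with a smaller key. -/
def rank (i : ι) : ℕ := (Finset.univ.filter fun i' => key i' < key i).card

theorem rank_lt (i : ι) : rank key i < Fintype.card ι :=
  Finset.card_lt_card (Finset.filter_ssubset.2 ⟨i, Finset.mem_univ i, lt_irrefl _⟩)

theorem rank_lt_rank {i i' : ι} (h : key i < key i') : rank key i < rank key i' :=
  Finset.card_lt_card ⟨Finset.monotone_filter_right _ fun _ _ hj => hj.trans h, fun hsub =>
    lt_irrefl _ (Finset.mem_filter.1 (hsub (Finset.mem_filter.2 ⟨Finset.mem_univ i, h⟩))).2⟩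

theorem rank_injective : Function.Injective (rank key) := by
  intro i i' he
  rcases lt_trichotomy (key i) (key i') with h | h | h
  · exact absurd he (rank_lt_rank key h).ne
  · exact key.injective h
  · exact absurd he (rank_lt_rank key h).ne'

end Rank

/-! ### Correctness of the queries -/

section Correctness

variable {N n k : ℕ} {lines : Finset (Finset (Fin N))} {line : TernaryQuery}

/-- On the net graph, the query `line` determines the line through two adjacent points. -/
def IsLineQuery (line : TernaryQuery) (lines : Finset (Finset (Fin N))) : Prop :=
  ∀ l ∈ lines, ∀ u v, u ≠ v → u ∈ l → v ∈ l →
    ∀ w, line N (netGraph lines).Adj u v w ↔ w ∈ l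

theorem IsNet.card_eq (h : IsNet n k lines) : N = n ^ 2 := by
  simpa only [Fintype.card_fin] using h.card_points

theorem inNhd_iff {G : SimpleGraph (Fin N)} {u v z : Fin N} :
    InNhd G.Adj u v z ↔ z ∈ edgeNhd G u v :=
  mem_edgeNhd.symm

open Classical in
theorem card_nhdAdj (G : SimpleGraph (Fin N)) (u v w : Fin N) :
    (Finset.univ.filter (NhdAdj G.Adj u v w)).card = degreeIn G (edgeNhd G u v) w := by
  rw [degreeIn]
  congr 1
  ext z
  simp [NhdAdj, inNhd_iff]

open Classical in
theorem card_eq_or_nhdAdj (G : SimpleGraph (Fin N)) (u v w : Fin N) :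
    (Finset.univ.filter fun z => z = w ∨ NhdAdj G.Adj u v w z).card =
      degreeIn G (edgeNhd G u v) w + 1 := by
  rw [← card_nhdAdj, ← Finset.card_insert_of_notMem (a := w) (by simp [NhdAdj])]
  congr 1
  ext z
  simp

theorem isLineQuery_majLine (h : IsNet n k lines) (hk : (k - 1) ^ 2 < n) :
    IsLineQuery MajLine lines := by
  classical
  intro l hl u v huv hu hv w
  rw [h.mem_line_iff hk huv hl hu hv, MajLine, inNhd_iff, pairCount_eq_self,
    pairCount_and fun y => y = w ∨ NhdAdj _ u v w y, card_eq_or_nhdAdj]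
  refine and_congr_right fun _ => ?_
  conv_lhs => lhs; rw [h.card_eq]
  rw [Nat.pow_le_pow_iff_left two_ne_zero, Nat.sub_le_iff_le_add]

theorem isLineQuery_boundedLine (h : IsNet n k lines) (hk : (k - 1) ^ 2 < n) {K : ℕ}
    (hK : k ≤ K) : IsLineQuery (BoundedLine ((K - 1) ^ 2)) lines := by
  intro l hl u v huv hu hv w
  have hc : (k - 1) ^ 2 ≤ (K - 1) ^ 2 := Nat.pow_le_pow_left (Nat.sub_le_sub_right hK 1) 2
  have hsq (s : ℕ) : N ≤ (s + 1) ^ 2 ↔ n ≤ s + 1 := by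
    conv_lhs => lhs; rw [h.card_eq]
    exact Nat.pow_le_pow_iff_left two_ne_zero
  simp only [BoundedLine, inNhd_iff, card_nhdAdj, List.mem_range, hsq]
  constructor
  · rintro ⟨hw, hd⟩
    by_contra hwl
    have hlt := h.degreeIn_lt huv hl hu hv hw hwl
    rcases hd with hd | ⟨s, -, hs, hd⟩ <;> omega
  · intro hw
    refine ⟨subset_edgeNhd_netGraph hl hu hv hw, ?_⟩
    have hd := h.le_degreeIn hl hu hv hw
    rcases Nat.lt_or_ge (n - 1) ((K - 1) ^ 2) with hs | hs
    · exact .inr ⟨n - 1, hs, by omega, hd⟩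
    · exact .inl (hs.trans hd)

theorem firstPair_iff (hline : IsLineQuery line lines) {u v : Fin N} :
    FirstPair line N (netGraph lines).Adj u v ↔ ∃ l ∈ lines, IsFirstPair l (u, v) := by
  constructor
  · rintro ⟨⟨hne, l, hl, hu, hv⟩, huv, hw⟩
    exact ⟨l, hl, hu, hv, huv, fun w hwl hwv => hw w hwv ((hline l hl u v hne hu hv w).2 hwl)⟩
  · rintro ⟨l, hl, hu, hv, huv, hw⟩
    exact ⟨⟨huv.ne, l, hl, hu, hv⟩, huv, fun w hwv hwl =>
      hw w ((hline l hl u v huv.ne hu hv w).1 hwl) hwv⟩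

/-- The key of a line is the index of its first pair among all pairs. -/
def IsKey (key : lines ↪ Fin (N * N)) : Prop :=
  ∀ l : lines, IsFirstPair l.1 ((key l).divNat, (key l).modNat)

theorem IsNet.exists_isKey (h : IsNet n k lines) (hn : 2 ≤ n) :
    ∃ key : lines ↪ Fin (N * N), IsKey key := by
  choose φ hφ using fun l : lines => exists_isFirstPair (hn.trans_eq (h.card_line l l.2).symm)
  have hinj : Function.Injective φ := by
    intro l l' he
    have hl := hφ l
    have hl' := hφ l'
    rw [← he] at hl'
    exact Subtype.ext (h.eq_of_mem l.2 l'.2 hl.2.2.1.ne hl.1 hl.2.1 hl'.1 hl'.2.1)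
  refine ⟨⟨finProdFinEquiv ∘ φ, finProdFinEquiv.injective.comp hinj⟩, fun l => ?_⟩
  exact (congrArg (IsFirstPair l.1) (finProdFinEquiv.symm_apply_apply (φ l))).mpr (hφ l)

namespace IsKey

variable {key : lines ↪ Fin (N * N)}

theorem firstPair_iff (hkey : IsKey key) (hline : IsLineQuery line lines) {j : Fin (N * N)} :
    FirstPair line N (netGraph lines).Adj j.divNat j.modNat ↔ ∃ l, key l = j := by
  rw [_root_.firstPair_iff hline]
  constructor
  · rintro ⟨l, hl, hp⟩
    exact ⟨⟨l, hl⟩, finProdFinEquiv.symm.injective ((hkey ⟨l, hl⟩).unique hp)⟩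
  · rintro ⟨l, rfl⟩
    exact ⟨l, l.2, hkey l⟩

theorem line_iff (hkey : IsKey key) (hline : IsLineQuery line lines) (l : lines) {p : Fin N} :
    line N (netGraph lines).Adj (key l).divNat (key l).modNat p ↔ p ∈ l.1 :=
  have ⟨hu, hv, huv, _⟩ := hkey l
  hline l.1 l.2 _ _ huv.ne hu hv p

theorem pairCount_firstPair (hkey : IsKey key) (hline : IsLineQuery line lines) (l : lines) :
    pairCount (fun a b => FirstPair line N (netGraph lines).Adj a b ∧
      LexLt a b (key l).divNat (key l).modNat) = rank key l := by
  classical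
  rw [pairCount_eq_card, rank, ← Finset.card_map key]
  congr 1
  ext i
  simp only [Finset.mem_filter_univ, Finset.mem_map, hkey.firstPair_iff hline,
    lexLt_divNat_modNat]
  constructor
  · rintro ⟨⟨l', rfl⟩, hlt⟩
    exact ⟨l', hlt, rfl⟩
  · rintro ⟨l', hlt, rfl⟩
    exact ⟨⟨l', rfl⟩, hlt⟩

theorem rankedEntry_iff (hkey : IsKey key) (hline : IsLineQuery line lines) (hN : 1 < N)
    {j : Fin (N * N)} {p : Fin N} :
    RankedEntry line N (netGraph lines).Adj j.divNat j.modNat p ↔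
      ∃ l : lines, p ∈ l.1 ∧ rank key l = j := by
  rw [RankedEntry, or_iff_right hN.not_ge, pairCount_lexLt]
  constructor
  · rintro ⟨u, v, ⟨hfirst, hp⟩, hcount⟩
    obtain ⟨i, hi⟩ := finProdFinEquiv.symm.surjective (u, v)
    obtain ⟨rfl, rfl⟩ := Prod.mk.inj hi
    obtain ⟨l, rfl⟩ := (hkey.firstPair_iff hline).1 hfirst
    exact ⟨l, (hkey.line_iff hline l).1 hp, (hkey.pairCount_firstPair hline l).symm.trans hcount⟩
  · rintro ⟨l, hp, hj⟩
    exact ⟨_, _, ⟨(hkey.firstPair_iff hline).2 ⟨l, rfl⟩, (hkey.line_iff hline l).2 hp⟩,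
      (hkey.pairCount_firstPair hline l).trans hj⟩

end IsKey

theorem isIncidenceMatrix_of_le_one (h : IsNet n k lines) (hN : N ≤ 1)
    {B : Fin N → Fin (N * N) → Bool} (hB : ∀ p j, p ∈ column B j) :
    IsIncidenceMatrix lines B := by
  obtain rfl : n = 1 := by
    have := h.one_le_order
    have := h.card_eq
    nlinarith
  obtain rfl : N = 1 := h.card_eq
  have huniv (l : lines) : l.1 = Finset.univ :=
    (Finset.card_eq_iff_eq_univ l.1).1 (h.card_line l l.2)
  have hsub : Subsingleton lines := ⟨fun l l' => Subtype.ext ((huniv l).trans (huniv l').symm)⟩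
  obtain ⟨l₀, hl₀⟩ : lines.Nonempty := by
    rw [← Finset.card_pos, h.card_lines, mul_one]
    exact h.one_le_degree
  refine ⟨⟨fun _ => 0, Function.injective_of_subsingleton _⟩, ⟨fun l => ?_, fun j hj => ?_⟩,
    fun l => Finset.card_pos.2 ⟨l, l.2⟩⟩
  · rw [huniv l]
    exact Finset.eq_univ_of_forall fun p => hB p _
  · exact absurd ⟨⟨l₀, hl₀⟩, Subsingleton.elim (α := Fin 1) _ _⟩ hj

theorem IsNet.two_le_order (h : IsNet n k lines) (hN : 1 < N) : 2 ≤ n := by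
  have := h.card_eq
  nlinarith

theorem isSparseIncidenceMatrix_entryMatrix (h : IsNet n k lines)
    (hline : IsLineQuery line lines) :
    IsSparseIncidenceMatrix lines (entryMatrix (SparseEntry line) (netGraph lines)) := by
  rcases Nat.lt_or_ge 1 N with hN | hN
  · obtain ⟨key, hkey⟩ := h.exists_isKey (h.two_le_order hN)
    have hmem (p : Fin N) (j : Fin (N * N)) :
        p ∈ column (entryMatrix (SparseEntry line) (netGraph lines)) j ↔
          (∃ l, key l = j) ∧ line N (netGraph lines).Adj j.divNat j.modNat p := by
      rw [mem_column_entryMatrix, SparseEntry, or_iff_right hN.not_ge, hkey.firstPair_iff hline]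
    refine ⟨key, fun l => ?_, fun j hj => Finset.eq_empty_of_forall_notMem fun p hp =>
      hj ((hmem p j).1 hp).1⟩
    ext p
    rw [hmem, hkey.line_iff hline]
    exact and_iff_right ⟨l, rfl⟩
  · exact (isIncidenceMatrix_of_le_one h hN fun _ _ =>
      mem_column_entryMatrix.2 (.inl hN)).imp fun _ => And.left

theorem isIncidenceMatrix_entryMatrix (h : IsNet n k lines) (hline : IsLineQuery line lines) :
    IsIncidenceMatrix lines (entryMatrix (RankedEntry line) (netGraph lines)) := by
  rcases Nat.lt_or_ge 1 N with hN | hN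
  · obtain ⟨key, hkey⟩ := h.exists_isKey (h.two_le_order hN)
    have hmem (p : Fin N) (j : Fin (N * N)) :
        p ∈ column (entryMatrix (RankedEntry line) (netGraph lines)) j ↔
          ∃ l : lines, p ∈ l.1 ∧ rank key l = j :=
      mem_column_entryMatrix.trans (hkey.rankedEntry_iff hline hN)
    have hrank (l : lines) : rank key l < lines.card :=
      (rank_lt key l).trans_eq (Fintype.card_coe lines)
    have hcard : lines.card ≤ N * N := by simpa using Fintype.card_le_of_embedding key
    refine ⟨⟨fun l => ⟨rank key l, (hrank l).trans_le hcard⟩, fun l l' he =>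
      rank_injective key (Fin.mk.inj he)⟩, ⟨fun l => ?_, fun j hj => ?_⟩, hrank⟩
    · ext p
      rw [hmem]
      exact ⟨fun ⟨l', hp, he⟩ => rank_injective key he ▸ hp, fun hp => ⟨l, hp, rfl⟩⟩
    · refine Finset.eq_empty_of_forall_notMem fun p hp => ?_
      obtain ⟨l, -, he⟩ := (hmem p j).1 hp
      exact hj ⟨l, Fin.ext he⟩
  · exact isIncidenceMatrix_of_le_one h hN fun _ _ => mem_column_entryMatrix.2 (.inl hN)

end Correctness

theorem mainTheorem10 :
    -- one family of `TC⁰` circuits, for all `n` and `k`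
    (∃ C : CircuitFamily, C.IsTC0 ∧
      ∀ (N n k : ℕ) (lines : Finset (Finset (Fin N))) (G : SimpleGraph (Fin N)),
        IsNet n k lines → G = netGraph lines → (k - 1) ^ 2 < n →
        ∃ B : Fin N → Fin (N * N) → Bool,
          (C (N * N)).output (graphBits G) = matrixBits B ∧ IsIncidenceMatrix lines B) ∧
    -- for every bound `K`, one family of `AC⁰` circuits for all `n` and all `k ≤ K`
    (∀ K : ℕ, ∃ C : CircuitFamily, C.IsAC0 ∧
      ∀ (N n k : ℕ) (lines : Finset (Finset (Fin N))) (G : SimpleGraph (Fin N)),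
        IsNet n k lines → G = netGraph lines → (k - 1) ^ 2 < n → k ≤ K →
        ∃ B : Fin N → Fin (N * N) → Bool,
          (C (N * N)).output (graphBits G) = matrixBits B ∧ IsSparseIncidenceMatrix lines B) ∧
    -- the line through two adjacent points, as a clique separated by degrees
    (∀ (N n k : ℕ) (lines : Finset (Finset (Fin N))) (G : SimpleGraph (Fin N)),
      IsNet n k lines → G = netGraph lines → (k - 1) ^ 2 < n →
      ∀ u v : Fin N, G.Adj u v →
        (∃! l : Finset (Fin N), l ∈ lines ∧ u ∈ l ∧ v ∈ l) ∧
        ∀ l ∈ lines, u ∈ l → v ∈ l →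
          l ⊆ edgeNhd G u v ∧ G.IsClique (l : Set (Fin N)) ∧
          (∀ w ∈ l, n - 1 ≤ degreeIn G (edgeNhd G u v) w) ∧
          (∀ w ∈ edgeNhd G u v, w ∉ l → degreeIn G (edgeNhd G u v) w < (k - 1) ^ 2)) := by
  refine ⟨?_, fun K => ?_, ?_⟩
  · obtain ⟨C, hC, -, hout⟩ := majLine.rankedEntry.exists_family
    refine ⟨C, hC, fun N n k lines G h hG hk => ?_⟩
    subst hG
    exact ⟨_, hout N _, isIncidenceMatrix_entryMatrix h (isLineQuery_majLine h hk)⟩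
  · obtain ⟨C, -, hC, hout⟩ :=
      (boundedLine (maj := false) ((K - 1) ^ 2)).sparseEntry.exists_family
    refine ⟨C, hC rfl, fun N n k lines G h hG hk hK => ?_⟩
    subst hG
    exact ⟨_, hout N _,
      isSparseIncidenceMatrix_entryMatrix h (isLineQuery_boundedLine h hk hK)⟩
  · intro N n k lines G h hG _ u v huv
    subst hG
    exact ⟨h.existsUnique_line huv, fun l hl hu hv =>
      ⟨subset_edgeNhd_netGraph hl hu hv, isClique_netGraph hl,
        fun w hw => h.le_degreeIn hl hu hv hw,
        fun w hw hwl => h.degreeIn_lt huv.ne hl hu hv hw hwl⟩⟩
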